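/- **Setting.** Let $L$ be a (left) Leibniz algebra over a field $\mathfrak k$, i.e. a vector space with a bilinear operation $\circ$ satisfying $x\circ(y\circ z)=(x\circ y)\circ z+y\circ(x\circ z)$. Let $Z=\{z\in L: z\circ x=0\ \forall x\in L\}$ be its left center and $(x,y)=x\circ y+y\circ x\in Z$ the symmetric product. Let $S^\bullet(Z)$ be the symmetric algebra of $Z$, and let $\rho(e)$ be the derivation of $S^\bullet(Z)$ with $\rho(e)f=e\circ f$ for $f\in Z$. For $n\in\mathbb Z$ let $C^n(L)$ be the space of sequences $\omega=(\omega_0,\omega_1,\dots)$ of linear maps $\omega_k:L^{\otimes(n-2k)}\otimes S^k(Z)\to S^\bullet(Z)$, $0\le 2k\le n$ (with $\omega_k=0$ for other $k$), such that $$\omega_k(\dots,e_i,e_{i+1},\dots;f_1,\dots,f_k)+\omega_k(\dots,e_{i+1},e_i,\dots;f_1,\dots,f_k)=-\omega_{k+1}(\dots,\widehat{e_i},\widehat{e_{i+1}},\dots;(e_i,e_{i+1}),f_1,\dots,f_k).$$ On $C(L)=\bigoplus_nC^n(L)$ consider the product $$(\omega\cdot\eta)_k(e_1,\dots;f_1,\dots,f_k)=\sum(-1)^\sigma\,\omega_i(e_{\sigma(1)},\dots,e_{\sigma(n-2i)};f_{\mu(1)},\dots,f_{\mu(i)})\,\eta_j(e_{\sigma(n-2i+1)},\dots;f_{\mu(i+1)},\dots,f_{\mu(k)}),$$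 $\omega\in C^n(L)$, $\eta\in C^m(L)$, the sum being over $i+j=k$, $\sigma\in sh(n-2i,m-2j)$, $\mu\in sh(i,j)$ (shuffle permutations), and the coboundary $$(d\omega)_k(e_1,\dots,e_{n+1-2k};f_1,\dots,f_k)=\sum_a(-1)^{a+1}\rho(e_a)\,\omega_k(\dots,\widehat{e_a},\dots;f_1,\dots,f_k)+\sum_{a<b}(-1)^a\omega_k(\dots,\widehat{e_a},\dots,e_a\circ e_b,\dots;f_1,\dots,f_k)+\sum_j\omega_{k-1}(f_j,e_1,\dots,e_{n+1-2k};\dots,\widehat{f_j},\dots),$$ where $e_a\circ e_b$ stands at the place of $e_b$. Extend the symmetric product $S^\bullet(Z)$-bilinearly to $S^\bullet(Z)\otimes L$ and let $\phi:S^\bullet(Z)\otimes L\to \mathrm{Hom}_{\mathfrak k}(L,S^\bullet(Z))$ be $\phi(u)(e)=(u,1\otimes e)$. A cochain $\omega\in C^n(L)$ is *representable* if for all $k$ and all $e_i\in L$, $f_j\in Z$ the map $e\mapsto\omega_k(e_1,\dots,e_{n-2k-1},e;f_1,\dots,f_k)$ lies in the image of $\phi$; then $\tilde\omega_k(e_1,\dots,e_{n-2k-1};f_1,\dots,f_k)\in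 S^\bullet(Z)\otimes L$ denotes a preimage of it under $\phi$. Let $\tilde C(L)=\bigoplus_n\tilde C^n(L)$ be the space of representable cochains. For $\omega\in\tilde C^n(L)$, $\eta\in\tilde C^m(L)$ put $\{\omega,\eta\}=\omega\bullet\eta+\omega\diamond\eta-(-1)^{nm}\eta\diamond\omega$, where $$(\omega\bullet\eta)_k(e_1,\dots;f_1,\dots,f_k)=(-1)^{m-1}\sum(-1)^\sigma\big(\tilde\omega_i(e_{\sigma(1)},\dots,e_{\sigma(n-2i-1)};f_{\mu(1)},\dots,f_{\mu(i)}),\ \tilde\eta_j(e_{\sigma(n-2i)},\dots;f_{\mu(i+1)},\dots,f_{\mu(k)})\big)$$ over $i+j=k$, $\sigma\in sh(n-2i-1,m-2j-1)$, $\mu\in sh(i,j)$ (this does not depend on the chosen preimages), and $$(\omega\diamond\eta)_k(e_1,\dots;f_1,\dots,f_k)=\sum(-1)^\sigma\,\omega_{i+1}\big(e_{\sigma(1)},\dots,e_{\sigma(n-2i-2)};\ \eta_j(e_{\sigma(n-2i-1)},\dots;f_{\mu(1)},\dots,f_{\mu(j)}),\,f_{\mu(j+1)},\dots,f_{\mu(k)}\big)$$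 over $i+j=k$, $\sigma\in sh(n-2i-2,m-2j)$, $\mu\in sh(j,i)$, with $\omega_{i+1}$ extended to $S^\bullet(Z)$ in its first argument from $Z$ by the Leibniz rule. **Theorem.** With this product and bracket, $\tilde C(L)$ is a graded Poisson algebra with bracket of degree $-2$. That is, for $\omega\in\tilde C^n(L)$, $\eta\in\tilde C^m(L)$, $\lambda\in\tilde C^l(L)$: - $\omega\cdot\eta\in\tilde C^{n+m}(L)$, and the product is bilinear, associative, unital with unit $1\in S^\bullet(Z)=\tilde C^0(L)$, and graded commutative, $\omega\cdot\eta=(-1)^{nm}\eta\cdot\omega$; - $\{\omega,\eta\}\in\tilde C^{n+m-2}(L)$, and the bracket is bilinear; - $\{\omega,\eta\}=-(-1)^{nm}\{\eta,\omega\}$; - $\{\omega,\eta\cdot\lambda\}=\{\omega,\eta\}\cdot\lambda+(-1)^{nm}\eta\cdot\{\omega,\lambda\}$; - $\{\omega,\{\eta,\lambda\}\}=\{\{\omega,\eta\},\lambda\}+(-1)^{nm}\{\eta,\{\omega,\lambda\}\}$. Moreover $d\omega\in\tilde C^{n+1}(L)$ for every $\omega\in\tilde C^n(L)$. -/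

import Mathlib

open scoped TensorProduct

/-- A (left) Leibniz algebra over a field: a vector space with a bilinear operation `x ∘ y`
satisfying the left Leibniz identity `x ∘ (y ∘ z) = (x ∘ y) ∘ z + y ∘ (x ∘ z)`. -/
class LeibnizAlgebra (𝕜 L : Type*) [Field 𝕜] [AddCommGroup L] [Module 𝕜 L] where
  /-- the Leibniz bracket `x ∘ y` -/
  op : L →ₗ[𝕜] L →ₗ[𝕜] L
  /-- the left Leibniz identity -/
  leibniz : ∀ x y z : L, op x (op y z) = op (op x y) z + op y (op x z)

/-- A graded Poisson algebra structure, with product of degree `0` and bracket of degree `-2`, on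
the graded vector space `⨁ n, A n`. The components `A n` are subspaces of one vector space `M`;
identities between elements of components whose degrees agree only up to arithmetic are stated in
`M`. -/
structure GradedPoissonAlgebra {𝕜 M : Type*} [Field 𝕜] [AddCommGroup M] [Module 𝕜 M]
    (A : ℤ → Submodule 𝕜 M) where
  /-- the unit -/
  one : A 0
  /-- the product, bilinear of degree `0` -/
  mul : ∀ {n m : ℤ}, A n →ₗ[𝕜] A m →ₗ[𝕜] A (n + m)
  /-- the bracket, bilinear of degree `-2` -/
  bracket : ∀ {n m : ℤ}, A n →ₗ[𝕜] A m →ₗ[𝕜] A (n + m - 2)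
  one_mul : ∀ {n : ℤ} (x : A n), (mul one x : M) = x
  mul_one : ∀ {n : ℤ} (x : A n), (mul x one : M) = x
  mul_assoc : ∀ {n m l : ℤ} (x : A n) (y : A m) (z : A l),
    (mul (mul x y) z : M) = mul x (mul y z)
  /-- `x y = (-1)^{nm} y x` -/
  mul_comm : ∀ {n m : ℤ} (x : A n) (y : A m),
    (mul x y : M) = ((n * m).negOnePow : ℤ) • (mul y x : M)
  /-- `{x, y} = -(-1)^{nm} {y, x}` -/
  bracket_antisymm : ∀ {n m : ℤ} (x : A n) (y : A m),
    (bracket x y : M) = -(((n * m).negOnePow : ℤ) • (bracket y x : M))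
  /-- `{x, y z} = {x, y} z + (-1)^{nm} y {x, z}` -/
  bracket_mul : ∀ {n m l : ℤ} (x : A n) (y : A m) (z : A l),
    (bracket x (mul y z) : M) =
      (mul (bracket x y) z : M) + ((n * m).negOnePow : ℤ) • (mul y (bracket x z) : M)
  /-- `{x, {y, z}} = {{x, y}, z} + (-1)^{nm} {y, {x, z}}` -/
  bracket_jacobi : ∀ {n m l : ℤ} (x : A n) (y : A m) (z : A l),
    (bracket x (bracket y z) : M) =
      (bracket (bracket x y) z : M) + ((n * m).negOnePow : ℤ) • (bracket y (bracket x z) : M)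

namespace LeibnizAlgebra

/-- All ways of splitting a list `(e₁, …, e_N)` into a subsequence and the complementary
subsequence. The entry `(s, (e_{σ 1}, …, e_{σ p}), (e_{σ (p+1)}, …, e_{σ N}))` belongs to the
`(p, N - p)`-shuffle `σ`, and `s = (-1)^σ` is its sign. Every shuffle, for every `p`, occurs exactly
once. In the recursion the first entry goes to the front of the left part, or to the front of the
right part, where it has to be moved past the whole left part. -/
def unshuffles {α : Type*} : List α → List (ℤ × List α × List α)
  | [] => [(1, [], [])]
  | x :: xs =>
      (unshuffles xs).map (fun t => (t.1, x :: t.2.1, t.2.2)) ++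
        (unshuffles xs).map (fun t => ((-1) ^ t.2.1.length * t.1, t.2.1, x :: t.2.2))

section Basic

variable (𝕜 L : Type*) [Field 𝕜] [AddCommGroup L] [Module 𝕜 L] [LeibnizAlgebra 𝕜 L]

/-- The left center `Z = {z | z ∘ x = 0 for all x}`. -/
def leftCenter : Submodule 𝕜 L := LinearMap.ker (op (𝕜 := 𝕜) (L := L))

/-- The symmetric algebra `S^•(Z)` of the left center. -/
abbrev SZ : Type _ := SymmetricAlgebra 𝕜 (leftCenter 𝕜 L)

variable {L}

theorem mem_leftCenter {z : L} : z ∈ leftCenter 𝕜 L ↔ ∀ x, op (𝕜 := 𝕜) z x = 0 := by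
  rw [leftCenter, LinearMap.mem_ker]
  exact ⟨fun h x => by rw [h]; rfl, fun h => LinearMap.ext h⟩

theorem symm_mem (x y : L) : op (𝕜 := 𝕜) x y + op (𝕜 := 𝕜) y x ∈ leftCenter 𝕜 L := by
  rw [mem_leftCenter]
  intro z
  have h1 := leibniz (𝕜 := 𝕜) x y z
  have h2 := leibniz (𝕜 := 𝕜) y x z
  rw [map_add, LinearMap.add_apply]
  rw [h2] at h1
  have h3 : op (𝕜 := 𝕜) (op (𝕜 := 𝕜) x y) z + op (𝕜 := 𝕜) (op (𝕜 := 𝕜) y x) z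
      + op (𝕜 := 𝕜) y (op (𝕜 := 𝕜) x z) = op (𝕜 := 𝕜) y (op (𝕜 := 𝕜) x z) := by
    rw [h2]
    nth_rewrite 2 [h1]
    abel
  simpa using h3

theorem op_mem (x : L) {z : L} (hz : z ∈ leftCenter 𝕜 L) :
    op (𝕜 := 𝕜) x z ∈ leftCenter 𝕜 L := by
  rw [mem_leftCenter] at hz ⊢
  intro y
  have h := leibniz (𝕜 := 𝕜) x z y
  rw [hz, hz, map_zero, add_zero] at h
  exact h.symm

variable (L)

/-- The symmetric product `(x, y) = x ∘ y + y ∘ x`, with values in `Z`. -/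
def pair : L →ₗ[𝕜] L →ₗ[𝕜] leftCenter 𝕜 L :=
  LinearMap.mk₂ 𝕜 (fun x y => ⟨op (𝕜 := 𝕜) x y + op (𝕜 := 𝕜) y x, symm_mem 𝕜 x y⟩)
    (fun x x' y => Subtype.ext (by simp; abel))
    (fun c x y => Subtype.ext (by simp))
    (fun x y y' => Subtype.ext (by simp; abel))
    (fun c x y => Subtype.ext (by simp))

/-- The left action `z ↦ x ∘ z` of `x` on the left center. -/
def actZ (x : L) : leftCenter 𝕜 L →ₗ[𝕜] leftCenter 𝕜 L :=
  (op (𝕜 := 𝕜) x).restrict (fun _ hz => op_mem 𝕜 x hz)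

/-- The algebra map `s ↦ s + ε D(s)` to the dual numbers over `S^•(Z)` that sends `z` to
`z + ε g(z)`. -/
noncomputable def derivAux (g : leftCenter 𝕜 L →ₗ[𝕜] SZ 𝕜 L) :
    SZ 𝕜 L →ₐ[𝕜] TrivSqZeroExt (SZ 𝕜 L) (SZ 𝕜 L) :=
  SymmetricAlgebra.lift
    ((TrivSqZeroExt.inlAlgHom 𝕜 (SZ 𝕜 L) (SZ 𝕜 L)).toLinearMap ∘ₗ SymmetricAlgebra.ι 𝕜 _ +
      (TrivSqZeroExt.inrHom (SZ 𝕜 L) (SZ 𝕜 L)).restrictScalars 𝕜 ∘ₗ g)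

variable {L}

theorem derivAux_fst (g : leftCenter 𝕜 L →ₗ[𝕜] SZ 𝕜 L) (s : SZ 𝕜 L) :
    (derivAux 𝕜 L g s).fst = s := by
  have h : (TrivSqZeroExt.fstHom 𝕜 (SZ 𝕜 L) (SZ 𝕜 L)).comp (derivAux 𝕜 L g)
      = AlgHom.id 𝕜 (SZ 𝕜 L) := by
    apply SymmetricAlgebra.algHom_ext
    ext z
    simp [derivAux]
  exact congrArg (fun F : SZ 𝕜 L →ₐ[𝕜] SZ 𝕜 L => F s) h

/-- The unique derivation of `S^•(Z)` that restricts to a given linear map on `Z`: the extension of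
the linear map by the Leibniz rule. -/
noncomputable def derivExt (g : leftCenter 𝕜 L →ₗ[𝕜] SZ 𝕜 L) :
    Derivation 𝕜 (SZ 𝕜 L) (SZ 𝕜 L) :=
  Derivation.mk'
    { toFun := fun s => (derivAux 𝕜 L g s).snd
      map_add' := fun s t => by simp
      map_smul' := fun c s => by simp }
    (fun s t => by simp [derivAux_fst]; ring)

@[simp]
theorem derivExt_ι (g : leftCenter 𝕜 L →ₗ[𝕜] SZ 𝕜 L) (z : leftCenter 𝕜 L) :
    derivExt 𝕜 g (SymmetricAlgebra.ι 𝕜 _ z) = g z := by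
  simp [derivExt, derivAux]

/-- The action `ρ(x)` on `S^•(Z)`: the extension of `z ↦ x ∘ z` by the Leibniz rule. -/
noncomputable def rho (x : L) : Derivation 𝕜 (SZ 𝕜 L) (SZ 𝕜 L) :=
  derivExt 𝕜 (SymmetricAlgebra.ι 𝕜 _ ∘ₗ actZ 𝕜 L x)

variable (L)

/-- The `S^•(Z)`-bilinear extension of the symmetric product to `S^•(Z) ⊗ L`:
`(s ⊗ x, t ⊗ y) = s t (x, y)`. -/
noncomputable def form : SZ 𝕜 L ⊗[𝕜] L →ₗ[𝕜] SZ 𝕜 L ⊗[𝕜] L →ₗ[𝕜] SZ 𝕜 L :=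
  (TensorProduct.map₂ (LinearMap.mul 𝕜 (SZ 𝕜 L))
    ((pair 𝕜 L).compr₂ (SymmetricAlgebra.ι 𝕜 _))).compr₂ (LinearMap.mul' 𝕜 (SZ 𝕜 L))

/-- The map `φ = (·, ) : S^•(Z) ⊗ L → Hom(L, S^•(Z))`. -/
noncomputable def phi : SZ 𝕜 L ⊗[𝕜] L →ₗ[𝕜] (L →ₗ[𝕜] SZ 𝕜 L) :=
  (form 𝕜 L).compl₂ (TensorProduct.mk 𝕜 (SZ 𝕜 L) L 1)

variable {L}

theorem form_tmul_tmul (s t : SZ 𝕜 L) (x y : L) :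
    form 𝕜 L (s ⊗ₜ x) (t ⊗ₜ y) = s * t * SymmetricAlgebra.ι 𝕜 _ (pair 𝕜 L x y) := by
  simp [form]

theorem form_symm (u v : SZ 𝕜 L ⊗[𝕜] L) : form 𝕜 L u v = form 𝕜 L v u := by
  induction u with
  | zero => simp
  | add a b ha hb => simp [ha, hb]
  | tmul s x =>
    induction v with
    | zero => simp
    | add a b ha hb => simp [ha, hb]
    | tmul t y =>
      rw [form_tmul_tmul, form_tmul_tmul, mul_comm s t]
      congr 2
      exact Subtype.ext (add_comm _ _)

theorem form_tmul_right (u : SZ 𝕜 L ⊗[𝕜] L) (t : SZ 𝕜 L) (y : L) :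
    form 𝕜 L u (t ⊗ₜ y) = t * phi 𝕜 L u y := by
  induction u with
  | zero => simp
  | add a b ha hb => simp [ha, hb, mul_add]
  | tmul s x =>
    simp only [phi, LinearMap.compl₂_apply, TensorProduct.mk_apply, form_tmul_tmul, mul_one]
    ring

/-- The product `(u, v)` depends only on `φ(u)` and `φ(v)`. -/
theorem form_congr {u u' v v' : SZ 𝕜 L ⊗[𝕜] L} (hu : phi 𝕜 L u = phi 𝕜 L u')
    (hv : phi 𝕜 L v = phi 𝕜 L v') : form 𝕜 L u v = form 𝕜 L u' v' := by
  have key : ∀ {a a' : SZ 𝕜 L ⊗[𝕜] L}, phi 𝕜 L a = phi 𝕜 L a' →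
      ∀ b, form 𝕜 L a b = form 𝕜 L a' b := by
    intro a a' h b
    induction b with
    | zero => simp
    | add b c hb hc => simp [hb, hc]
    | tmul t y => rw [form_tmul_right, form_tmul_right, h]
  rw [key hu v, form_symm, key hv u', form_symm]

end Basic

section Cochains

variable (𝕜 L : Type*) [Field 𝕜] [AddCommGroup L] [Module 𝕜 L] [LeibnizAlgebra 𝕜 L]

/-- The vector space of all functions `ω(e₁, …, e_p; f₁, …, f_k)` of finitely many arguments in `L`
and finitely many arguments in `Z`, with values in `S^•(Z)`. -/
abbrev PreCochain : Type _ := List L → List (leftCenter 𝕜 L) → SZ 𝕜 L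

/-- The space `C^n(L) = C^n(L, Z, S^•(Z))`. A sequence `(ω₀, ω₁, …)` with
`ω_k : L^{⊗(n-2k)} ⊗ S^k(Z) → S^•(Z)` is encoded as one function `ω`: its value at a list of
length `p` in `L` and a list of length `k` in `Z` is the value of `ω_k` if `p = n - 2k`, and `0`
otherwise. There are no nonzero cochains of negative degree. -/
structure IsCochain (n : ℤ) (ω : PreCochain 𝕜 L) : Prop where
  degree : ∀ es fs, (es.length : ℤ) + 2 * fs.length ≠ n → ω es fs = 0
  /-- linearity in each argument from `L` -/
  linear_L : ∀ (a b : List L) (fs) (c : 𝕜) (x y : L),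
    ω (a ++ (c • x + y) :: b) fs = c • ω (a ++ x :: b) fs + ω (a ++ y :: b) fs
  /-- linearity in each argument from `Z` -/
  linear_Z : ∀ (es) (a b : List (leftCenter 𝕜 L)) (c : 𝕜) (x y : leftCenter 𝕜 L),
    ω es (a ++ (c • x + y) :: b) = c • ω es (a ++ x :: b) + ω es (a ++ y :: b)
  /-- symmetry in the arguments from `Z` -/
  symm_Z : ∀ (es) (fs fs' : List (leftCenter 𝕜 L)), fs.Perm fs' → ω es fs = ω es fs'
  /-- `ω_k` is weakly skew-symmetric in the arguments from `L` up to `ω_{k+1}` -/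
  weak_skew : ∀ (a b : List L) (x y : L) (fs),
    ω (a ++ x :: y :: b) fs + ω (a ++ y :: x :: b) fs = -ω (a ++ b) (pair 𝕜 L x y :: fs)

/-- `C^n(L)` as a subspace. -/
def C (n : ℤ) : Submodule 𝕜 (PreCochain 𝕜 L) where
  carrier := {ω | IsCochain 𝕜 L n ω}
  zero_mem' := by constructor <;> intros <;> simp
  add_mem' := by
    intro ω η hω hη
    refine ⟨fun es fs h => ?_, fun a b fs c x y => ?_, fun es a b c x y => ?_,
      fun es fs fs' h => ?_, fun a b x y fs => ?_⟩
    · simp [hω.degree es fs h, hη.degree es fs h]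
    · simp only [Pi.add_apply, hω.linear_L, hη.linear_L, smul_add]; abel
    · simp only [Pi.add_apply, hω.linear_Z, hη.linear_Z, smul_add]; abel
    · simp only [Pi.add_apply, hω.symm_Z es fs fs' h, hη.symm_Z es fs fs' h]
    · simp only [Pi.add_apply, neg_add, ← hω.weak_skew, ← hη.weak_skew]; abel
  smul_mem' := by
    intro r ω hω
    refine ⟨fun es fs h => ?_, fun a b fs c x y => ?_, fun es a b c x y => ?_,
      fun es fs fs' h => ?_, fun a b x y fs => ?_⟩
    · simp [hω.degree es fs h]
    · simp only [Pi.smul_apply, hω.linear_L, smul_add, smul_comm r c]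
    · simp only [Pi.smul_apply, hω.linear_Z, smul_add, smul_comm r c]
    · simp only [Pi.smul_apply, hω.symm_Z es fs fs' h]
    · simp only [Pi.smul_apply, ← smul_add, ← smul_neg, ← hω.weak_skew]

variable {𝕜 L}

/-- The map `e ↦ ω_k(e₁, …, e_{n-2k-1}, e; f₁, …, f_k)`. -/
def bar {n : ℤ} (ω : C 𝕜 L n) (es : List L) (fs : List (leftCenter 𝕜 L)) : L →ₗ[𝕜] SZ 𝕜 L :=
  IsLinearMap.mk' (fun e => ω.1 (es ++ [e]) fs)
    { map_add := fun x y => by simpa using ω.2.linear_L es [] fs 1 x y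
      map_smul := fun c x => by
        have h0 : ω.1 (es ++ [0]) fs = 0 := by simpa using ω.2.linear_L es [] fs 1 0 0
        simpa [h0] using ω.2.linear_L es [] fs c x 0 }

variable (𝕜 L)

/-- The space `C̃^n(L)` of representable cochains of degree `n`: those `ω ∈ C^n(L)` all of whose
maps `e ↦ ω_k(e₁, …, e_{n-2k-1}, e; f₁, …, f_k)` lie in the image of `φ`. -/
def Ctilde (n : ℤ) : Submodule 𝕜 (PreCochain 𝕜 L) :=
  Submodule.map (C 𝕜 L n).subtype
    { carrier := {ω | ∀ es fs, bar ω es fs ∈ LinearMap.range (phi 𝕜 L)}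
      zero_mem' := fun _ _ => (LinearMap.range (phi 𝕜 L)).zero_mem
      add_mem' := fun h h' es fs => (LinearMap.range (phi 𝕜 L)).add_mem (h es fs) (h' es fs)
      smul_mem' := fun c _ h es fs => (LinearMap.range (phi 𝕜 L)).smul_mem c (h es fs) }

theorem Ctilde_le (n : ℤ) : Ctilde 𝕜 L n ≤ C 𝕜 L n := Submodule.map_subtype_le _ _

variable {𝕜 L}

/-- A representable cochain as a cochain. -/
def toC {n : ℤ} (ω : Ctilde 𝕜 L n) : C 𝕜 L n := Submodule.inclusion (Ctilde_le 𝕜 L n) ω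

theorem bar_mem_range {n : ℤ} (ω : Ctilde 𝕜 L n) (es : List L) (fs : List (leftCenter 𝕜 L)) :
    bar (toC ω) es fs ∈ LinearMap.range (phi 𝕜 L) := by
  obtain ⟨_, η, hη, rfl⟩ := ω
  exact hη es fs

/-- The element `ω̃_k(e₁, …, e_{n-2k-1})(f₁, …, f_k)` of `S^•(Z) ⊗ L`: a chosen preimage under `φ`
of `e ↦ ω_k(e₁, …, e_{n-2k-1}, e; f₁, …, f_k)`. The choice is irrelevant where it is used, by
`form_congr`. -/
noncomputable def tilde {n : ℤ} (ω : Ctilde 𝕜 L n) (es : List L) (fs : List (leftCenter 𝕜 L)) :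
    SZ 𝕜 L ⊗[𝕜] L :=
  Classical.choose (bar_mem_range ω es fs)

theorem phi_tilde {n : ℤ} (ω : Ctilde 𝕜 L n) (es : List L) (fs : List (leftCenter 𝕜 L)) :
    phi 𝕜 L (tilde ω es fs) = bar (toC ω) es fs :=
  Classical.choose_spec (bar_mem_range ω es fs)

/-- The map `f ↦ ω_k(e₁, …, e_{n-2k}; f, f₂, …, f_k)`. -/
def headZ {n : ℤ} (ω : C 𝕜 L n) (es : List L) (fs : List (leftCenter 𝕜 L)) :
    leftCenter 𝕜 L →ₗ[𝕜] SZ 𝕜 L :=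
  IsLinearMap.mk' (fun f => ω.1 es (f :: fs))
    { map_add := fun x y => by simpa using ω.2.linear_Z es [] fs 1 x y
      map_smul := fun c x => by
        have h0 : ω.1 es (0 :: fs) = 0 := by simpa using ω.2.linear_Z es [] fs 1 0 0
        simpa [h0] using ω.2.linear_Z es [] fs c x 0 }

/-- The coboundary `d = d₀ + δ` of the standard complex. The positions `a`, `b`, `j` are counted
from `0`, so that the sign of the position `a` is `(-1)^a` in the first sum and `-(-1)^a` in the
second one, where `e_a` is removed and `e_b` is replaced by `e_a ∘ e_b`. -/
noncomputable def d (ω : PreCochain 𝕜 L) : PreCochain 𝕜 L := fun es fs =>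
  (∑ a : Fin es.length, (-1 : ℤ) ^ (a : ℕ) • rho 𝕜 (es.get a) (ω (es.eraseIdx a) fs))
    - (∑ a : Fin es.length, ∑ b : Fin es.length,
        if a < b then
          (-1 : ℤ) ^ (a : ℕ) •
            ω ((es.set b (op (𝕜 := 𝕜) (es.get a) (es.get b))).eraseIdx a) fs
        else 0)
    + ∑ j : Fin fs.length, ω ((fs.get j : L) :: es) (fs.eraseIdx j)

/-- The constant `1 ∈ S^•(Z) = C^0(L)`. -/
def unit : PreCochain 𝕜 L
  | [], [] => 1
  | _, _ => 0

/-- The product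
`(ω·η)_k(e₁, …; f₁, …, f_k) = ∑ (-1)^σ ω_i(e_{σ 1}, …; f_{μ 1}, …) η_j(…, e_{σ(n+m-2k)}; …, f_{μ k})`
over `i + j = k`, `σ ∈ sh(n-2i, m-2j)` and `μ ∈ sh(i, j)`. The sum may be taken over all shuffles
of both argument lists, as the terms for other lengths of the parts are zero. -/
def shuffleMul (ω η : PreCochain 𝕜 L) : PreCochain 𝕜 L := fun es fs =>
  ((unshuffles es).map fun s =>
    ((unshuffles fs).map fun t => s.1 • (ω s.2.1 t.2.1 * η s.2.2 t.2.2)).sum).sum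

/-- The operation `ω • η`, for `ω` and `η` representable of degrees `n` and `m`:
`(ω • η)_k(e₁, …; f₁, …, f_k)
  = (-1)^{m-1} ∑ (-1)^σ (ω̃_i(e_{σ 1}, …)(f_{μ 1}, …), η̃_j(e_{σ(n-2i)}, …)(f_{μ(i+1)}, …))`
over `i + j = k`, `σ ∈ sh(n-2i-1, m-2j-1)` and `μ ∈ sh(i, j)`. The terms for other lengths of the
parts are zero. -/
noncomputable def bullet {n m : ℤ} (ω : Ctilde 𝕜 L n) (η : Ctilde 𝕜 L m) : PreCochain 𝕜 L :=
  fun es fs => ((m - 1).negOnePow : ℤ) •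
    ((unshuffles es).map fun s =>
      ((unshuffles fs).map fun t =>
        s.1 • form 𝕜 L (tilde ω s.2.1 t.2.1) (tilde η s.2.2 t.2.2)).sum).sum

/-- The operation `ω ◇ η`, for `ω` and `η` of degrees `n` and `m`:
`(ω ◇ η)_k(e₁, …; f₁, …, f_k)
  = ∑ (-1)^σ ω_{i+1}(e_{σ 1}, …; η_j(e_{σ(n-2i-1)}, …; f_{μ 1}, …, f_{μ j}), f_{μ(j+1)}, …, f_{μ k})`
over `i + j = k`, `σ ∈ sh(n-2i-2, m-2j)` and `μ ∈ sh(j, i)`, where `ω_{i+1}` is extended by the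
Leibniz rule to `S^•(Z)` in its first argument from `Z`. The terms for other lengths of the parts
are zero. -/
noncomputable def diamond {n m : ℤ} (ω : C 𝕜 L n) (η : C 𝕜 L m) : PreCochain 𝕜 L :=
  fun es fs =>
    ((unshuffles es).map fun s =>
      ((unshuffles fs).map fun t =>
        s.1 • derivExt 𝕜 (headZ ω s.2.1 t.2.2) (η.1 s.2.2 t.2.1)).sum).sum

/-- The bracket `{ω, η} = ω • η + ω ◇ η - (-1)^{nm} η ◇ ω` of representable cochains of degrees `n`
and `m`. -/
noncomputable def poisson {n m : ℤ} (ω : Ctilde 𝕜 L n) (η : Ctilde 𝕜 L m) : PreCochain 𝕜 L :=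
  bullet ω η + diamond (toC ω) (toC η)
    - ((n * m).negOnePow : ℤ) • diamond (toC η) (toC ω)

end Cochains

end LeibnizAlgebra

/-!
All functions `ω(e₁, …; f₁, …)` are studied through their contractions `ι_x ω = ω(x, …; …)`, for
`x ∈ L`, and `ι_z ω = ω(…; z, …)`, for `z ∈ Z`. The recursion for shuffles shows that `ι_x` is an
odd and `ι_z` an even derivation of the product (`contractL_mul`, `contractZ_mul`) and of the bracket
(`contractL_bracketFun`, `contractZ_bracketFun`). In terms of contractions, weak skew-symmetry says
that `ι_y ι_x + ι_x ι_y = -ι_{(x, y)}`, and this relation passes from the factors to products and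
brackets.

Consequently every assertion is proved by induction on the arguments. An identity holds if its
defect vanishes on empty argument lists and the contractions of the defect are combinations of
defects of the same kind (`eq_zero_of_contractions`). A function is a representable cochain if it
belongs to a family that is stable under contractions and satisfies conditions on the first
arguments only (`mem_Ctilde_of_contractions`). For the bracket, the one such condition with content
is representability in degree `1`, where the two halves of the bracket compensate each other
(`exists_phi_form_add_derivExt`).

For the Jacobi identity the initial case has total degree `4`, so that one of the three cochains has
degree at most `1`. Such cochains are generated over `S^•(Z)` by elements `z ∈ Z`, for which
`{z, ·} = -ι_z`, and by linear forms `(e, ·)`, for which `{(e, ·), ·} = ι_e`. For these the Jacobi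
identity is the derivation property of contractions, and it extends to `S^•(Z)`-combinations
because the Jacobiator is a derivation (`jacobiator_mul`).

For the coboundary, `ι_z d = d ι_z + ι_z` with the last contraction in `L` (`contractZ_d`), and
`ι_x d + d ι_x = ℒ_x` with a Lie derivative that preserves representable cochains (`contractL_d`,
`lieDeriv_mem`).
-/

open scoped TensorProduct

namespace LeibnizAlgebra

/-! ### Signs -/

/-- The sign `(-1)^n`, as an integer. -/
abbrev sgn (n : ℤ) : ℤ := (n.negOnePow : ℤ)

theorem sgn_add (n m : ℤ) : sgn (n + m) = sgn n * sgn m := by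
  simp [sgn, Int.negOnePow_add]

theorem sgn_sub (n m : ℤ) : sgn (n - m) = sgn n * sgn m := by
  simp [sgn, Int.negOnePow_sub]

theorem sgn_one : sgn 1 = -1 := by simp [sgn]

theorem sgn_two : sgn 2 = 1 := by simp [sgn, Int.negOnePow_even 2 even_two]

theorem sgn_zero : sgn 0 = 1 := by simp [sgn]

/-- Case distinction on parity, with the sign of every product that contains `n` as a factor. -/
theorem sgn_cases (n : ℤ) :
    (sgn n = 1 ∧ (∀ m, sgn (n * m) = 1) ∧ ∀ m, sgn (m * n) = 1) ∨
      (sgn n = -1 ∧ (∀ m, sgn (n * m) = sgn m) ∧ ∀ m, sgn (m * n) = sgn m) := by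
  rcases Int.even_or_odd n with h | h
  · left
    refine ⟨by simp [sgn, Int.negOnePow_even n h], fun m => ?_, fun m => ?_⟩
    · simp [sgn, Int.negOnePow_even _ (h.mul_right m)]
    · simp [sgn, Int.negOnePow_even _ (h.mul_left m)]
  · right
    have key : ∀ m, sgn (n * m) = sgn m := by
      intro m
      rcases Int.even_or_odd m with h' | h'
      · simp [sgn, Int.negOnePow_even _ (h'.mul_left n), Int.negOnePow_even _ h']
      · simp [sgn, Int.negOnePow_odd _ (h.mul h'), Int.negOnePow_odd _ h']
    exact ⟨by simp [sgn, Int.negOnePow_odd n h], key, fun m => by rw [mul_comm]; exact key m⟩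

/-- The length of the list of arguments from `L` has the parity of the degree. -/
theorem neg_one_pow_eq_sgn {n : ℤ} {p k : ℕ} (h : (p : ℤ) + 2 * k = n) :
    (-1 : ℤ) ^ p = sgn n := by
  rw [← h, sgn_add]
  rw [sgn, sgn, Int.negOnePow_even (2 * (k : ℤ)) (even_two_mul _)]
  simp [Int.negOnePow_def]

/-! ### Derivations of the symmetric algebra and the form on `S^•(Z) ⊗ L` -/

section Basic

variable {𝕜 L : Type*} [Field 𝕜] [AddCommGroup L] [Module 𝕜 L] [LeibnizAlgebra 𝕜 L]

/-- A derivation of `S^•(Z)` is determined by its restriction to `Z`. -/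
theorem eq_derivExt (D : Derivation 𝕜 (SZ 𝕜 L) (SZ 𝕜 L)) (g : leftCenter 𝕜 L →ₗ[𝕜] SZ 𝕜 L)
    (h : ∀ z, D (SymmetricAlgebra.ι 𝕜 _ z) = g z) : D = derivExt 𝕜 g := by
  ext s
  induction s using SymmetricAlgebra.induction with
  | algebraMap r => simp
  | ι z => rw [h, derivExt_ι]
  | mul a b ha hb => simp [ha, hb]
  | add a b ha hb => simp [ha, hb]

theorem derivExt_add (g g' : leftCenter 𝕜 L →ₗ[𝕜] SZ 𝕜 L) :
    derivExt 𝕜 (g + g') = derivExt 𝕜 g + derivExt 𝕜 g' :=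
  (eq_derivExt _ _ (by simp)).symm

theorem derivExt_smul (c : 𝕜) (g : leftCenter 𝕜 L →ₗ[𝕜] SZ 𝕜 L) :
    derivExt 𝕜 (c • g) = c • derivExt 𝕜 g :=
  (eq_derivExt _ _ (by simp)).symm

theorem derivExt_mul_smul (s : SZ 𝕜 L) (g : leftCenter 𝕜 L →ₗ[𝕜] SZ 𝕜 L) :
    derivExt 𝕜 (s • g) = s • derivExt 𝕜 g :=
  (eq_derivExt _ _ (by simp)).symm

@[simp]
theorem derivExt_zero : derivExt 𝕜 (0 : leftCenter 𝕜 L →ₗ[𝕜] SZ 𝕜 L) = 0 :=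
  (eq_derivExt _ _ (by simp)).symm

theorem phi_tmul (s : SZ 𝕜 L) (x y : L) :
    phi 𝕜 L (s ⊗ₜ x) y = s * SymmetricAlgebra.ι 𝕜 _ (pair 𝕜 L x y) := by
  simp [phi, form_tmul_tmul]

theorem phi_smul (s : SZ 𝕜 L) (u : SZ 𝕜 L ⊗[𝕜] L) (y : L) :
    phi 𝕜 L (s • u) y = s * phi 𝕜 L u y := by
  induction u with
  | zero => simp
  | add a b ha hb => simp only [smul_add, map_add, LinearMap.add_apply, ha, hb, mul_add]
  | tmul t x => rw [TensorProduct.smul_tmul', smul_eq_mul, phi_tmul, phi_tmul, mul_assoc]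

theorem form_smul_left (s : SZ 𝕜 L) (u v : SZ 𝕜 L ⊗[𝕜] L) :
    form 𝕜 L (s • u) v = s * form 𝕜 L u v := by
  induction v with
  | zero => simp
  | add a b ha hb => simp only [map_add, ha, hb, mul_add]
  | tmul t x => rw [form_tmul_right, form_tmul_right, phi_smul]; ring

theorem form_eq_zero {u : SZ 𝕜 L ⊗[𝕜] L} (hu : ∀ x, phi 𝕜 L u x = 0) (v : SZ 𝕜 L ⊗[𝕜] L) :
    form 𝕜 L u v = 0 := by
  rw [form_congr 𝕜 (u' := 0) (v' := v) (by ext x; simp [hu]) rfl]; simp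

theorem pair_comm (x y : L) : pair 𝕜 L x y = pair 𝕜 L y x := Subtype.ext (add_comm _ _)

theorem pair_leftCenter (x : L) (z : leftCenter 𝕜 L) : pair 𝕜 L x z = actZ 𝕜 L x z := by
  have h := (mem_leftCenter 𝕜).1 z.2 x
  exact Subtype.ext (by simp [pair, actZ, h])

theorem actZ_pair (e x y : L) : actZ 𝕜 L e (pair 𝕜 L x y) =
    pair 𝕜 L (op (𝕜 := 𝕜) e x) y + pair 𝕜 L x (op (𝕜 := 𝕜) e y) := by
  apply Subtype.ext
  simp [pair, actZ, leibniz (𝕜 := 𝕜) e]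
  abel

theorem rho_ι (x : L) (z : leftCenter 𝕜 L) :
    rho 𝕜 x (SymmetricAlgebra.ι 𝕜 _ z) = SymmetricAlgebra.ι 𝕜 _ (actZ 𝕜 L x z) := by
  simp [rho]

theorem rho_add_smul (c : 𝕜) (x y : L) : rho 𝕜 (c • x + y) = c • rho 𝕜 x + rho 𝕜 y := by
  refine (eq_derivExt _ _ fun z => ?_).symm
  have : actZ 𝕜 L (c • x + y) z = c • actZ 𝕜 L x z + actZ 𝕜 L y z :=
    Subtype.ext (by simp [actZ])
  simp [rho_ι, this]

/-- For a family of derivations, the representable families are closed under evaluation at any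
element of `S^•(Z)`, as soon as this holds on `Z`. -/
theorem exists_phi_derivation (D : L → Derivation 𝕜 (SZ 𝕜 L) (SZ 𝕜 L))
    (h : ∀ z, ∃ u, ∀ x, phi 𝕜 L u x = D x (SymmetricAlgebra.ι 𝕜 _ z)) (s : SZ 𝕜 L) :
    ∃ u, ∀ x, phi 𝕜 L u x = D x s := by
  induction s using SymmetricAlgebra.induction with
  | algebraMap r => exact ⟨0, by simp⟩
  | ι z => exact h z
  | mul a b ha hb =>
    obtain ⟨u, hu⟩ := ha
    obtain ⟨v, hv⟩ := hb
    exact ⟨a • v + b • u, fun x => by simp [phi_smul, hu, hv]⟩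
  | add a b ha hb =>
    obtain ⟨u, hu⟩ := ha
    obtain ⟨v, hv⟩ := hb
    exact ⟨u + v, fun x => by simp [hu, hv]⟩

/-- The map `x ↦ ρ(x) s` is representable, since `x ∘ z = (x, z)` for `z ∈ Z`. -/
theorem exists_phi_rho (s : SZ 𝕜 L) : ∃ u, ∀ x, phi 𝕜 L u x = rho 𝕜 x s := by
  refine exists_phi_derivation (rho 𝕜) (fun z => ⟨1 ⊗ₜ (z : L), fun x => ?_⟩) s
  rw [phi_tmul, one_mul, rho_ι, ← pair_leftCenter, pair_comm]

/-- By invariance of the symmetric product, `ρ(e)(u, x) - (u, e ∘ x) = (e · u, x)`, where `e` acts on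
both factors of `u ∈ S^•(Z) ⊗ L`. -/
theorem exists_phi_rho_sub (e : L) (u : SZ 𝕜 L ⊗[𝕜] L) :
    ∃ v, ∀ x, phi 𝕜 L v x = rho 𝕜 e (phi 𝕜 L u x) - phi 𝕜 L u (op (𝕜 := 𝕜) e x) := by
  induction u with
  | zero => exact ⟨0, by simp⟩
  | add a b ha hb =>
    obtain ⟨u, hu⟩ := ha
    obtain ⟨v, hv⟩ := hb
    exact ⟨u + v, fun x => by simp [hu, hv]; abel⟩
  | tmul s y =>
    refine ⟨rho 𝕜 e s ⊗ₜ y + s ⊗ₜ op (𝕜 := 𝕜) e y, fun x => ?_⟩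
    simp only [map_add, LinearMap.add_apply, phi_tmul, Derivation.leibniz, rho_ι, actZ_pair,
      smul_eq_mul]
    ring

end Basic

/-! ### Sums over shuffles -/

section Shuffles

variable {α β R : Type*} [AddCommGroup R]

/-- The sum of `± F (e_σ', f_μ', e_σ'', f_μ'')` over all pairs of shuffles `σ` of `es` and `μ` of
`fs`, where primes denote left and right parts. -/
def shuffleSum (F : List α → List β → List α → List β → R) (es : List α) (fs : List β) : R :=
  ((unshuffles es).map fun s =>
    ((unshuffles fs).map fun t => s.1 • F s.2.1 t.2.1 s.2.2 t.2.2).sum).sum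

@[simp]
theorem shuffleSum_nil (F : List α → List β → List α → List β → R) :
    shuffleSum F [] [] = F [] [] [] [] := by
  simp [shuffleSum, unshuffles]

theorem shuffleSum_add (F G : List α → List β → List α → List β → R) (es fs) :
    shuffleSum (fun a c b d => F a c b d + G a c b d) es fs =
      shuffleSum F es fs + shuffleSum G es fs := by
  simp [shuffleSum, List.sum_map_add]

theorem shuffleSum_smul {K : Type*} [Ring K] [Module K R] (k : K)
    (F : List α → List β → List α → List β → R) (es fs) :
    shuffleSum (fun a c b d => k • F a c b d) es fs = k • shuffleSum F es fs := by
  simp only [shuffleSum, List.smul_sum, List.map_map, Function.comp_def, smul_comm k]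

theorem shuffleSum_cons_left (F : List α → List β → List α → List β → R) (e es fs) :
    shuffleSum F (e :: es) fs = shuffleSum (fun a c b d => F (e :: a) c b d) es fs +
      shuffleSum (fun a c b d => (-1 : ℤ) ^ a.length • F a c (e :: b) d) es fs := by
  simp only [shuffleSum, unshuffles, List.map_append, List.sum_append, List.map_map,
    Function.comp_def, smul_smul, mul_comm]

theorem shuffleSum_cons_right (F : List α → List β → List α → List β → R) (es f fs) :
    shuffleSum F es (f :: fs) = shuffleSum (fun a c b d => F a (f :: c) b d) es fs +
      shuffleSum (fun a c b d => F a c b (f :: d)) es fs := by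
  simp only [shuffleSum, unshuffles, List.map_append, List.sum_append, List.map_map,
    Function.comp_def, List.sum_map_add]

end Shuffles

section Cochains

variable {𝕜 L : Type*} [Field 𝕜] [AddCommGroup L] [Module 𝕜 L] [LeibnizAlgebra 𝕜 L]

/-! ### Contractions -/

variable (𝕜) in
/-- The contraction `ι_x ω = ω(x, …; …)` with `x ∈ L`. -/
def contractL (x : L) : PreCochain 𝕜 L →ₗ[𝕜] PreCochain 𝕜 L where
  toFun ω := fun es fs => ω (x :: es) fs
  map_add' _ _ := rfl
  map_smul' _ _ := rfl

/-- The contraction `ι_z ω = ω(…; z, …)` with `z ∈ Z`. -/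
def contractZ (z : leftCenter 𝕜 L) : PreCochain 𝕜 L →ₗ[𝕜] PreCochain 𝕜 L where
  toFun ω := fun es fs => ω es (z :: fs)
  map_add' _ _ := rfl
  map_smul' _ _ := rfl

theorem contractL_apply (x : L) (ω : PreCochain 𝕜 L) (es fs) :
    contractL 𝕜 x ω es fs = ω (x :: es) fs := rfl

theorem contractZ_apply (z : leftCenter 𝕜 L) (ω : PreCochain 𝕜 L) (es fs) :
    contractZ z ω es fs = ω es (z :: fs) := rfl

theorem contractZ_contractL (z : leftCenter 𝕜 L) (x : L) (ω : PreCochain 𝕜 L) :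
    contractZ z (contractL 𝕜 x ω) = contractL 𝕜 x (contractZ z ω) := rfl

/-- Induction over the arguments: a set of functions that is closed under contractions, up to
linear combinations, and whose elements vanish on empty argument lists contains only `0`. -/
theorem eq_zero_of_contractions (G : Set (PreCochain 𝕜 L)) (h0 : ∀ ω ∈ G, ω [] [] = 0)
    (hL : ∀ ω ∈ G, ∀ x, contractL 𝕜 x ω ∈ Submodule.span 𝕜 G)
    (hZ : ∀ ω ∈ G, ∀ z, contractZ z ω ∈ Submodule.span 𝕜 G) : ∀ ω ∈ G, ω = 0 := by
  have hL' : ∀ ω ∈ Submodule.span 𝕜 G, ∀ x, contractL 𝕜 x ω ∈ Submodule.span 𝕜 G := by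
    intro ω hω x
    have : Submodule.span 𝕜 G ≤ (Submodule.span 𝕜 G).comap (contractL 𝕜 x) :=
      Submodule.span_le.2 fun ω hω => hL ω hω x
    exact this hω
  have hZ' : ∀ ω ∈ Submodule.span 𝕜 G, ∀ z, contractZ z ω ∈ Submodule.span 𝕜 G := by
    intro ω hω z
    have : Submodule.span 𝕜 G ≤ (Submodule.span 𝕜 G).comap (contractZ z) :=
      Submodule.span_le.2 fun ω hω => hZ ω hω z
    exact this hω
  have h0' : ∀ ω ∈ Submodule.span 𝕜 G, ω [] [] = 0 := by
    intro ω hω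
    induction hω using Submodule.span_induction with
    | mem ω h => exact h0 ω h
    | zero => rfl
    | add a b _ _ ha hb => simp [ha, hb]
    | smul c a _ ha => simp [ha]
  intro ω hω
  have key : ∀ es fs, ∀ ω ∈ Submodule.span 𝕜 G, ω es fs = 0 := by
    intro es
    induction es with
    | nil =>
      intro fs
      induction fs with
      | nil => exact h0'
      | cons z fs ih => exact fun ω hω => ih _ (hZ' ω hω z)
    | cons x es ih => exact fun fs ω hω => ih fs _ (hL' ω hω x)
  funext es fs
  exact key es fs ω (Submodule.subset_span hω)

/-! ### Representable cochains through contractions -/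

theorem mem_Ctilde_iff {n : ℤ} {ω : PreCochain 𝕜 L} : ω ∈ Ctilde 𝕜 L n ↔
    IsCochain 𝕜 L n ω ∧ ∀ es fs, ∃ u, ∀ e, phi 𝕜 L u e = ω (es ++ [e]) fs := by
  constructor
  · rintro ⟨η, hη, rfl⟩
    refine ⟨η.2, fun es fs => ?_⟩
    obtain ⟨u, hu⟩ := hη es fs
    exact ⟨u, fun e => by rw [hu]; rfl⟩
  · rintro ⟨h, h'⟩
    refine ⟨⟨ω, h⟩, fun es fs => ?_, rfl⟩
    obtain ⟨u, hu⟩ := h' es fs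
    exact ⟨u, LinearMap.ext fun e => hu e⟩

section Properties

variable {n : ℤ} {ω : PreCochain 𝕜 L}

theorem apply_eq_zero (h : ω ∈ Ctilde 𝕜 L n) {es : List L} {fs : List (leftCenter 𝕜 L)}
    (hd : (es.length : ℤ) + 2 * fs.length ≠ n) : ω es fs = 0 :=
  (mem_Ctilde_iff.1 h).1.degree es fs hd

theorem contractL_mem (h : ω ∈ Ctilde 𝕜 L n) (x : L) : contractL 𝕜 x ω ∈ Ctilde 𝕜 L (n - 1) := by
  obtain ⟨h, h'⟩ := mem_Ctilde_iff.1 h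
  refine mem_Ctilde_iff.2 ⟨⟨fun es fs hd => h.degree _ _ ?_, fun a b => h.linear_L (x :: a) b,
    fun es => h.linear_Z (x :: es), fun es => h.symm_Z (x :: es), fun a => h.weak_skew (x :: a)⟩,
    fun es => h' (x :: es)⟩
  simp only [List.length_cons]; push_cast; omega

theorem contractZ_mem (h : ω ∈ Ctilde 𝕜 L n) (z : leftCenter 𝕜 L) :
    contractZ z ω ∈ Ctilde 𝕜 L (n - 2) := by
  obtain ⟨h, h'⟩ := mem_Ctilde_iff.1 h
  refine mem_Ctilde_iff.2 ⟨⟨fun es fs hd => h.degree _ _ ?_, fun a b fs => h.linear_L a b _,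
    fun es a => h.linear_Z es (z :: a), fun es fs fs' hp => h.symm_Z es _ _ (hp.cons z),
    fun a b x y fs => ?_⟩, fun es fs => h' es _⟩
  · simp only [List.length_cons]; push_cast; omega
  · rw [contractZ_apply, contractZ_apply, contractZ_apply, h.weak_skew,
      h.symm_Z _ _ _ (List.Perm.swap _ _ _)]

theorem contractL_add_smul (h : ω ∈ Ctilde 𝕜 L n) (c : 𝕜) (x y : L) :
    contractL 𝕜 (c • x + y) ω = c • contractL 𝕜 x ω + contractL 𝕜 y ω := by
  funext es fs
  exact (mem_Ctilde_iff.1 h).1.linear_L [] es fs c x y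

theorem contractZ_add_smul (h : ω ∈ Ctilde 𝕜 L n) (c : 𝕜) (x y : leftCenter 𝕜 L) :
    contractZ (c • x + y) ω = c • contractZ x ω + contractZ y ω := by
  funext es fs
  exact (mem_Ctilde_iff.1 h).1.linear_Z es [] fs c x y

theorem contractZ_comm (h : ω ∈ Ctilde 𝕜 L n) (x y : leftCenter 𝕜 L) :
    contractZ x (contractZ y ω) = contractZ y (contractZ x ω) := by
  funext es fs
  exact (mem_Ctilde_iff.1 h).1.symm_Z es _ _ (List.Perm.swap _ _ _)

theorem contractL_skew (h : ω ∈ Ctilde 𝕜 L n) (x y : L) :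
    contractL 𝕜 y (contractL 𝕜 x ω) + contractL 𝕜 x (contractL 𝕜 y ω) =
      -contractZ (pair 𝕜 L x y) ω := by
  funext es fs
  exact (mem_Ctilde_iff.1 h).1.weak_skew [] es x y fs

theorem exists_phi (h : ω ∈ Ctilde 𝕜 L n) (es : List L) (fs : List (leftCenter 𝕜 L)) :
    ∃ u, ∀ x, phi 𝕜 L u x = ω (es ++ [x]) fs := (mem_Ctilde_iff.1 h).2 es fs

theorem eq_zero_of_neg (h : ω ∈ Ctilde 𝕜 L n) (hn : n < 0) : ω = 0 := by
  funext es fs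
  exact apply_eq_zero h (by omega)

end Properties

variable (𝕜 L) in
/-- The conditions on a representable cochain of degree `n` that involve only the first arguments.
If they hold for all iterated contractions, the function is a representable cochain. -/
def initialConditions (n : ℤ) : Submodule 𝕜 (PreCochain 𝕜 L) where
  carrier := {ω | (n ≠ 0 → ω [] [] = 0) ∧ (∃ u, ∀ x, phi 𝕜 L u x = ω [x] []) ∧
    (∀ (c : 𝕜) (x y : L),
      contractL 𝕜 (c • x + y) ω = c • contractL 𝕜 x ω + contractL 𝕜 y ω) ∧
    (∀ (c : 𝕜) (x y : leftCenter 𝕜 L),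
      contractZ (c • x + y) ω = c • contractZ x ω + contractZ y ω) ∧
    (∀ x y : leftCenter 𝕜 L, contractZ x (contractZ y ω) = contractZ y (contractZ x ω)) ∧
    ∀ x y : L, contractL 𝕜 y (contractL 𝕜 x ω) + contractL 𝕜 x (contractL 𝕜 y ω) =
      -contractZ (pair 𝕜 L x y) ω}
  zero_mem' := ⟨fun _ => rfl, ⟨0, by simp⟩, by simp, by simp, by simp, by simp⟩
  add_mem' := by
    rintro ω η ⟨h1, ⟨u, hu⟩, h3, h4, h5, h6⟩ ⟨h1', ⟨u', hu'⟩, h3', h4', h5', h6'⟩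
    refine ⟨fun hn => by simp [h1 hn, h1' hn], ⟨u + u', fun x => by simp [hu, hu']⟩,
      fun c x y => ?_, fun c x y => ?_, fun x y => ?_, fun x y => ?_⟩
    · rw [map_add, h3, h3', map_add, map_add]; module
    · rw [map_add, h4, h4', map_add, map_add]; module
    · simp only [map_add, h5 x y, h5' x y]
    · simp only [map_add, neg_add, ← h6 x y, ← h6' x y]; abel
  smul_mem' := by
    rintro r ω ⟨h1, ⟨u, hu⟩, h3, h4, h5, h6⟩
    refine ⟨fun hn => by simp [h1 hn], ⟨r • u, fun x => by simp [hu]⟩,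
      fun c x y => ?_, fun c x y => ?_, fun x y => ?_, fun x y => ?_⟩
    · rw [map_smul, h3, map_smul, map_smul]; module
    · rw [map_smul, h4, map_smul, map_smul]; module
    · simp only [map_smul, h5 x y]
    · simp only [map_smul, ← smul_add, ← smul_neg, h6 x y]

theorem Ctilde_le_initialConditions (n : ℤ) : Ctilde 𝕜 L n ≤ initialConditions 𝕜 L n :=
  fun _ h => ⟨fun hn => apply_eq_zero h (by simpa using hn.symm), exists_phi h [] [],
    contractL_add_smul h, contractZ_add_smul h, contractZ_comm h, contractL_skew h⟩

/-- Coinductive membership criterion: a family of functions that is closed under contractions, up to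
linear combinations, and satisfies the initial conditions consists of representable cochains. -/
theorem mem_Ctilde_of_contractions (G : ℤ → Set (PreCochain 𝕜 L))
    (hG : ∀ n, ∀ ω ∈ G n, ω ∈ initialConditions 𝕜 L n)
    (hL : ∀ n, ∀ ω ∈ G n, ∀ x, contractL 𝕜 x ω ∈ Submodule.span 𝕜 (G (n - 1)))
    (hZ : ∀ n, ∀ ω ∈ G n, ∀ z, contractZ z ω ∈ Submodule.span 𝕜 (G (n - 2)))
    {n : ℤ} {ω : PreCochain 𝕜 L} (hω : ω ∈ G n) : ω ∈ Ctilde 𝕜 L n := by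
  set S : ℤ → Submodule 𝕜 (PreCochain 𝕜 L) := fun n => Submodule.span 𝕜 (G n) with hS
  have hG' : ∀ {n ω}, ω ∈ S n → ω ∈ initialConditions 𝕜 L n := by
    intro n ω hω
    exact (Submodule.span_le.2 (hG n)) hω
  have hL' : ∀ {n ω}, ω ∈ S n → ∀ x, contractL 𝕜 x ω ∈ S (n - 1) := by
    intro n ω hω x
    have : S n ≤ (S (n - 1)).comap (contractL 𝕜 x) :=
      Submodule.span_le.2 fun ω hω => hL n ω hω x
    exact this hω
  have hZ' : ∀ {n ω}, ω ∈ S n → ∀ z, contractZ z ω ∈ S (n - 2) := by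
    intro n ω hω z
    have : S n ≤ (S (n - 2)).comap (contractZ z) :=
      Submodule.span_le.2 fun ω hω => hZ n ω hω z
    exact this hω
  replace hω : ω ∈ S n := Submodule.subset_span hω
  clear_value S
  refine mem_Ctilde_iff.2 ⟨⟨fun es fs => ?_, fun a b fs c x y => ?_, fun es a b c x y => ?_,
    fun es fs fs' hp => ?_, fun a b x y fs => ?_⟩, fun es fs => ?_⟩
  · induction es generalizing n ω with
    | nil =>
      induction fs generalizing n ω with
      | nil => intro h; exact (hG' hω).1 (by simpa using h.symm)
      | cons z fs ih =>
        intro h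
        refine ih (hZ' hω z) ?_
        simp only [List.length_cons] at h ⊢; push_cast at h; omega
    | cons x es ih =>
      intro h
      refine ih (hL' hω x) ?_
      simp only [List.length_cons] at h; push_cast at h; omega
  · induction a generalizing n ω with
    | nil => exact congrFun (congrFun ((hG' hω).2.2.1 c x y) b) fs
    | cons e a ih => exact ih (hL' hω e)
  · induction es generalizing n ω with
    | nil =>
      induction a generalizing n ω with
      | nil => exact congrFun (congrFun ((hG' hω).2.2.2.1 c x y) []) b
      | cons z a ih => exact ih (hZ' hω z)
    | cons e es ih => exact ih (hL' hω e)
  · induction es generalizing n ω with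
    | nil =>
      induction hp generalizing n ω with
      | nil => rfl
      | cons z _ ih => exact ih (hZ' hω z)
      | swap x y l => exact congrFun (congrFun ((hG' hω).2.2.2.2.1 x y) []) l
      | trans _ _ ih ih' => exact Eq.trans (ih hω) (ih' hω)
    | cons e es ih => exact ih (hL' hω e)
  · induction a generalizing n ω with
    | nil => exact congrFun (congrFun ((hG' hω).2.2.2.2.2 x y) b) fs
    | cons e a ih => exact ih (hL' hω e)
  · induction es generalizing n ω with
    | nil =>
      induction fs generalizing n ω with
      | nil => exact (hG' hω).2.1
      | cons z fs ih => exact ih (hZ' hω z)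
    | cons x es ih => exact ih (hL' hω x)

/-! ### The product -/

variable (𝕜 L) in
/-- The product `shuffleMul` as a bilinear map. -/
noncomputable def mulLin : PreCochain 𝕜 L →ₗ[𝕜] PreCochain 𝕜 L →ₗ[𝕜] PreCochain 𝕜 L :=
  LinearMap.mk₂ 𝕜 shuffleMul
    (fun ω ω' η => by
      funext es fs
      exact Eq.trans (by simp [shuffleMul, shuffleSum, add_mul])
        (shuffleSum_add (fun a c b d => ω a c * η b d) (fun a c b d => ω' a c * η b d) es fs))
    (fun k ω η => by
      funext es fs
      exact Eq.trans (by simp [shuffleMul, shuffleSum])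
        (shuffleSum_smul k (fun a c b d => ω a c * η b d) es fs))
    (fun ω η η' => by
      funext es fs
      exact Eq.trans (by simp [shuffleMul, shuffleSum, mul_add])
        (shuffleSum_add (fun a c b d => ω a c * η b d) (fun a c b d => ω a c * η' b d) es fs))
    (fun k ω η => by
      funext es fs
      exact Eq.trans (by simp [shuffleMul, shuffleSum])
        (shuffleSum_smul k (fun a c b d => ω a c * η b d) es fs))

theorem mulLin_apply (ω η : PreCochain 𝕜 L) (es fs) :
    mulLin 𝕜 L ω η es fs = shuffleSum (fun a c b d => ω a c * η b d) es fs := rfl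

theorem mulLin_nil (ω η : PreCochain 𝕜 L) : mulLin 𝕜 L ω η [] [] = ω [] [] * η [] [] := by
  rw [mulLin_apply, shuffleSum_nil]

/-- In the sign of a contracted product, the length of the left part may be replaced by the degree of
the left factor. -/
theorem sign_smul_apply {n : ℤ} {ω : PreCochain 𝕜 L} (h : ω ∈ Ctilde 𝕜 L n) (es : List L)
    (fs : List (leftCenter 𝕜 L)) : (-1 : ℤ) ^ es.length • ω es fs = sgn n • ω es fs := by
  by_cases hd : (es.length : ℤ) + 2 * fs.length = n
  · rw [neg_one_pow_eq_sgn hd]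
  · rw [apply_eq_zero h hd, smul_zero, smul_zero]

/-- `ι_x` is an odd derivation of the product. -/
theorem contractL_mul {n : ℤ} {ω : PreCochain 𝕜 L} (h : ω ∈ Ctilde 𝕜 L n) (η : PreCochain 𝕜 L)
    (x : L) : contractL 𝕜 x (mulLin 𝕜 L ω η) =
      mulLin 𝕜 L (contractL 𝕜 x ω) η + sgn n • mulLin 𝕜 L ω (contractL 𝕜 x η) := by
  funext es fs
  rw [contractL_apply, mulLin_apply, shuffleSum_cons_left]
  simp only [Pi.add_apply, Pi.smul_apply, mulLin_apply, ← shuffleSum_smul, contractL_apply,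
    ← smul_mul_assoc, sign_smul_apply h]

/-- `ι_z` is a derivation of the product. -/
theorem contractZ_mul (ω η : PreCochain 𝕜 L) (z : leftCenter 𝕜 L) :
    contractZ z (mulLin 𝕜 L ω η) =
      mulLin 𝕜 L (contractZ z ω) η + mulLin 𝕜 L ω (contractZ z η) := by
  funext es fs
  rw [contractZ_apply, mulLin_apply, shuffleSum_cons_right]
  rfl

theorem mul_mem {n m k : ℤ} {ω η : PreCochain 𝕜 L} (hω : ω ∈ Ctilde 𝕜 L n)
    (hη : η ∈ Ctilde 𝕜 L m) (hk : n + m = k) : mulLin 𝕜 L ω η ∈ Ctilde 𝕜 L k := by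
  refine mem_Ctilde_of_contractions (fun k => {μ | ∃ (n m : ℤ) (ω η : PreCochain 𝕜 L),
    ω ∈ Ctilde 𝕜 L n ∧ η ∈ Ctilde 𝕜 L m ∧ n + m = k ∧ μ = mulLin 𝕜 L ω η}) ?_ ?_ ?_
    ⟨n, m, ω, η, hω, hη, hk, rfl⟩
  · rintro k _ ⟨n, m, ω, η, hω, hη, hk, rfl⟩
    refine ⟨fun hk0 => ?_, ?_, fun c x y => ?_, fun c x y => ?_, fun x y => ?_, fun x y => ?_⟩
    · rw [mulLin_nil]
      by_cases hn : n = 0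
      · rw [apply_eq_zero hη (by simp; omega), mul_zero]
      · rw [apply_eq_zero hω (by simp; omega), zero_mul]
    · obtain ⟨u, hu⟩ := exists_phi hω [] []
      obtain ⟨v, hv⟩ := exists_phi hη [] []
      refine ⟨η [] [] • u + ω [] [] • v, fun x => ?_⟩
      rw [mulLin_apply, shuffleSum_cons_left, shuffleSum_nil, shuffleSum_nil]
      simp only [map_add, LinearMap.add_apply, phi_smul, hu, hv]
      simp [mul_comm]
    · simp only [contractL_mul hω, contractL_add_smul hω, contractL_add_smul hη, map_add, map_smul,
        LinearMap.add_apply, LinearMap.smul_apply]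
      module
    · simp only [contractZ_mul, contractZ_add_smul hω, contractZ_add_smul hη, map_add, map_smul,
        LinearMap.add_apply, LinearMap.smul_apply]
      module
    · simp only [contractZ_mul, contractZ_comm hω x y, contractZ_comm hη x y, map_add]
      abel
    · have h1 := congrArg (fun μ => mulLin 𝕜 L μ η) (contractL_skew hω x y)
      have h2 := congrArg (mulLin 𝕜 L ω) (contractL_skew hη x y)
      simp only [contractL_mul hω, contractZ_mul, map_add, map_zsmul,
        contractL_mul (contractL_mem hω _), neg_add, map_neg, LinearMap.add_apply,
        LinearMap.neg_apply] at h1 h2 ⊢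
      rcases sgn_cases n with h | h <;> simp only [sgn_sub, sgn_one, h.1] <;>
        linear_combination (norm := module) h1 + h2
  · rintro k _ ⟨n, m, ω, η, hω, hη, hk, rfl⟩ x
    rw [contractL_mul hω]
    refine Submodule.add_mem _ (Submodule.subset_span ⟨_, _, _, _, contractL_mem hω x, hη, by omega, rfl⟩)
      (Submodule.smul_of_tower_mem _ _
        (Submodule.subset_span ⟨_, _, _, _, hω, contractL_mem hη x, by omega, rfl⟩))
  · rintro k _ ⟨n, m, ω, η, hω, hη, hk, rfl⟩ x
    rw [contractZ_mul]
    refine Submodule.add_mem _ (Submodule.subset_span ⟨_, _, _, _, contractZ_mem hω x, hη, by omega, rfl⟩)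
      (Submodule.subset_span ⟨_, _, _, _, hω, contractZ_mem hη x, by omega, rfl⟩)

theorem mulLin_assoc {n m l : ℤ} {ω η μ : PreCochain 𝕜 L} (hω : ω ∈ Ctilde 𝕜 L n)
    (hη : η ∈ Ctilde 𝕜 L m) (hμ : μ ∈ Ctilde 𝕜 L l) :
    mulLin 𝕜 L (mulLin 𝕜 L ω η) μ = mulLin 𝕜 L ω (mulLin 𝕜 L η μ) := by
  rw [← sub_eq_zero]
  refine eq_zero_of_contractions {δ | ∃ (n m l : ℤ) (ω η μ : PreCochain 𝕜 L),
    ω ∈ Ctilde 𝕜 L n ∧ η ∈ Ctilde 𝕜 L m ∧ μ ∈ Ctilde 𝕜 L l ∧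
    δ = mulLin 𝕜 L (mulLin 𝕜 L ω η) μ - mulLin 𝕜 L ω (mulLin 𝕜 L η μ)} ?_ ?_ ?_ _
    ⟨n, m, l, ω, η, μ, hω, hη, hμ, rfl⟩
  · rintro _ ⟨n, m, l, ω, η, μ, hω, hη, hμ, rfl⟩
    simp [mulLin_nil, mul_assoc]
  · rintro _ ⟨n, m, l, ω, η, μ, hω, hη, hμ, rfl⟩ x
    have h1 := Submodule.subset_span (R := 𝕜) (s := {δ | ∃ (n m l : ℤ) (ω η μ : PreCochain 𝕜 L),
      ω ∈ Ctilde 𝕜 L n ∧ η ∈ Ctilde 𝕜 L m ∧ μ ∈ Ctilde 𝕜 L l ∧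
      δ = mulLin 𝕜 L (mulLin 𝕜 L ω η) μ - mulLin 𝕜 L ω (mulLin 𝕜 L η μ)})
    convert add_mem (add_mem (h1 ⟨_, _, _, _, _, _, contractL_mem hω x, hη, hμ, rfl⟩)
      (zsmul_mem (h1 ⟨_, _, _, _, _, _, hω, contractL_mem hη x, hμ, rfl⟩) (sgn n)))
      (zsmul_mem (h1 ⟨_, _, _, _, _, _, hω, hη, contractL_mem hμ x, rfl⟩) (sgn (n + m))) using 1
    simp only [map_sub, contractL_mul hω, contractL_mul hη, contractL_mul (mul_mem hω hη rfl),
      map_add, map_zsmul, LinearMap.add_apply, LinearMap.smul_apply, sgn_add]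
    module
  · rintro _ ⟨n, m, l, ω, η, μ, hω, hη, hμ, rfl⟩ z
    have h1 := Submodule.subset_span (R := 𝕜) (s := {δ | ∃ (n m l : ℤ) (ω η μ : PreCochain 𝕜 L),
      ω ∈ Ctilde 𝕜 L n ∧ η ∈ Ctilde 𝕜 L m ∧ μ ∈ Ctilde 𝕜 L l ∧
      δ = mulLin 𝕜 L (mulLin 𝕜 L ω η) μ - mulLin 𝕜 L ω (mulLin 𝕜 L η μ)})
    convert add_mem (add_mem (h1 ⟨_, _, _, _, _, _, contractZ_mem hω z, hη, hμ, rfl⟩)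
      (h1 ⟨_, _, _, _, _, _, hω, contractZ_mem hη z, hμ, rfl⟩))
      (h1 ⟨_, _, _, _, _, _, hω, hη, contractZ_mem hμ z, rfl⟩) using 1
    simp only [map_sub, contractZ_mul, map_add, LinearMap.add_apply]
    abel

theorem mulLin_comm {n m : ℤ} {ω η : PreCochain 𝕜 L} (hω : ω ∈ Ctilde 𝕜 L n)
    (hη : η ∈ Ctilde 𝕜 L m) :
    mulLin 𝕜 L ω η = sgn (n * m) • mulLin 𝕜 L η ω := by
  rw [← sub_eq_zero]
  set G : Set (PreCochain 𝕜 L) := {δ | ∃ (n m : ℤ) (ω η : PreCochain 𝕜 L),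
    ω ∈ Ctilde 𝕜 L n ∧ η ∈ Ctilde 𝕜 L m ∧
    δ = mulLin 𝕜 L ω η - sgn (n * m) • mulLin 𝕜 L η ω} with hG
  have h1 := Submodule.subset_span (R := 𝕜) (s := G)
  refine eq_zero_of_contractions G ?_ ?_ ?_ _ ⟨n, m, ω, η, hω, hη, rfl⟩
  · rintro _ ⟨n, m, ω, η, hω, hη, rfl⟩
    simp only [Pi.sub_apply, Pi.smul_apply, mulLin_nil]
    by_cases hn : n = 0
    · subst hn; simp [mul_comm]
    · simp [apply_eq_zero hω (es := []) (fs := []) (by simp; omega)]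
  · rintro _ ⟨n, m, ω, η, hω, hη, rfl⟩ x
    convert add_mem (h1 ⟨_, _, _, _, contractL_mem hω x, hη, rfl⟩)
      (zsmul_mem (h1 ⟨_, _, _, _, hω, contractL_mem hη x, rfl⟩) (sgn n)) using 1
    simp only [map_sub, map_zsmul, contractL_mul hω, contractL_mul hη]
    rcases sgn_cases n with h | h <;> rcases sgn_cases m with h' | h' <;>
      simp only [sgn_sub, sgn_one, h.1, h.2, h'.1, h'.2] <;> module
  · rintro _ ⟨n, m, ω, η, hω, hη, rfl⟩ z
    convert add_mem (h1 ⟨_, _, _, _, contractZ_mem hω z, hη, rfl⟩)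
      (h1 ⟨_, _, _, _, hω, contractZ_mem hη z, rfl⟩) using 1
    simp only [map_sub, map_zsmul, contractZ_mul]
    rcases sgn_cases n with h | h <;> rcases sgn_cases m with h' | h' <;>
      simp only [sgn_sub, sgn_two, h.1, h.2, h'.1, h'.2] <;> module

/-! ### Cochains of degree zero and one -/

/-- The element `s ∈ S^•(Z)` as a cochain of degree `0`. -/
def const (s : SZ 𝕜 L) : PreCochain 𝕜 L
  | [], [] => s
  | _, _ => 0

/-- The element `u ∈ S^•(Z) ⊗ L` as the cochain `φ(u)` of degree `1`. -/
noncomputable def linearCochain (u : SZ 𝕜 L ⊗[𝕜] L) : PreCochain 𝕜 L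
  | [x], [] => phi 𝕜 L u x
  | _, _ => 0

theorem unit_eq : (unit : PreCochain 𝕜 L) = const 1 := by
  funext es fs
  cases es <;> cases fs <;> rfl

@[simp]
theorem const_nil (s : SZ 𝕜 L) : const s [] [] = s := rfl

@[simp]
theorem contractL_const (x : L) (s : SZ 𝕜 L) : contractL 𝕜 x (const s) = 0 := by
  funext es fs; rfl

@[simp]
theorem contractZ_const (z : leftCenter 𝕜 L) (s : SZ 𝕜 L) : contractZ z (const s) = 0 := by
  funext es fs; cases es <;> rfl

@[simp]
theorem contractL_linearCochain (x : L) (u : SZ 𝕜 L ⊗[𝕜] L) :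
    contractL 𝕜 x (linearCochain u) = const (phi 𝕜 L u x) := by
  funext es fs; cases es <;> cases fs <;> rfl

@[simp]
theorem contractZ_linearCochain (z : leftCenter 𝕜 L) (u : SZ 𝕜 L ⊗[𝕜] L) :
    contractZ z (linearCochain u) = 0 := by
  funext es fs
  rcases es with _ | ⟨x, _ | _⟩ <;> rfl

theorem const_mem (s : SZ 𝕜 L) : const s ∈ Ctilde 𝕜 L 0 := by
  refine mem_Ctilde_of_contractions (fun n => {ω | n = 0 ∧ ω = const s}) ?_ ?_ ?_ ⟨rfl, rfl⟩
  · rintro n _ ⟨rfl, rfl⟩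
    exact ⟨by simp, ⟨0, fun x => rfl⟩, by simp, by simp, by simp, by simp⟩
  · rintro n _ ⟨rfl, rfl⟩ x; simp
  · rintro n _ ⟨rfl, rfl⟩ x; simp

theorem const_add (s t : SZ 𝕜 L) : const (s + t) = const s + const t := by
  funext es fs; cases es <;> cases fs <;> simp [const]

theorem const_smul (c : 𝕜) (s : SZ 𝕜 L) : const (c • s) = c • const s := by
  funext es fs; cases es <;> cases fs <;> simp [const]

theorem linearCochain_mem (u : SZ 𝕜 L ⊗[𝕜] L) : linearCochain u ∈ Ctilde 𝕜 L 1 := by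
  refine mem_Ctilde_of_contractions (fun n => {ω | (n = 1 ∧ ω = linearCochain u) ∨
    ω ∈ Ctilde 𝕜 L n}) ?_ ?_ ?_ (Or.inl ⟨rfl, rfl⟩)
  · rintro n _ (⟨rfl, rfl⟩ | h)
    · refine ⟨fun _ => rfl, ⟨u, fun x => rfl⟩, ?_, by simp, by simp, by simp⟩
      simp [const_add, const_smul]
    · exact Ctilde_le_initialConditions n h
  · rintro n _ (⟨rfl, rfl⟩ | h) x
    · rw [contractL_linearCochain]
      exact Submodule.subset_span (Or.inr (const_mem _))
    · exact Submodule.subset_span (Or.inr (contractL_mem h x))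
  · rintro n _ (⟨rfl, rfl⟩ | h) x
    · simp
    · exact Submodule.subset_span (Or.inr (contractZ_mem h x))

theorem eq_const {ω : PreCochain 𝕜 L} (h : ω ∈ Ctilde 𝕜 L 0) : ω = const (ω [] []) := by
  funext es fs
  rcases es with _ | ⟨x, es⟩
  · rcases fs with _ | ⟨z, fs⟩
    · rfl
    · exact apply_eq_zero h (by simp only [List.length_cons]; push_cast; omega)
  · exact apply_eq_zero h (by simp only [List.length_cons]; push_cast; omega)

theorem exists_eq_linearCochain {ω : PreCochain 𝕜 L} (h : ω ∈ Ctilde 𝕜 L 1) :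
    ∃ u, ω = linearCochain u := by
  obtain ⟨u, hu⟩ := exists_phi h [] []
  refine ⟨u, ?_⟩
  funext es fs
  rcases es with _ | ⟨x, _ | ⟨y, es⟩⟩
  · rcases fs with _ | ⟨z, fs⟩
    · exact apply_eq_zero h (by simp)
    · exact apply_eq_zero h (by simp only [List.length_cons, List.length_nil]; push_cast; omega)
  · rcases fs with _ | ⟨z, fs⟩
    · exact (hu x).symm
    · exact apply_eq_zero h (by simp only [List.length_cons, List.length_nil]; push_cast; omega)
  · exact apply_eq_zero h (by simp only [List.length_cons]; push_cast; omega)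

theorem const_mul {n : ℤ} {ω : PreCochain 𝕜 L} (h : ω ∈ Ctilde 𝕜 L n) (s : SZ 𝕜 L) (es fs) :
    mulLin 𝕜 L (const s) ω es fs = s * ω es fs := by
  induction es generalizing n ω with
  | nil =>
    induction fs generalizing n ω with
    | nil => simp [mulLin_nil]
    | cons z fs ih =>
      change contractZ z (mulLin 𝕜 L (const s) ω) [] fs = _
      rw [contractZ_mul, contractZ_const, map_zero, LinearMap.zero_apply,
        zero_add, ih (contractZ_mem h z)]
      rfl
  | cons x es ih =>
    change contractL 𝕜 x (mulLin 𝕜 L (const s) ω) es fs = _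
    rw [contractL_mul (const_mem s), contractL_const, map_zero,
      LinearMap.zero_apply, zero_add, sgn_zero, one_smul, ih (contractL_mem h x)]
    rfl

/-! ### The bracket on functions -/

open Classical in
/-- A preimage of `x ↦ ω(es, x; fs)` under `φ`, and `0` if there is none. -/
noncomputable def lift (ω : PreCochain 𝕜 L) (es : List L) (fs : List (leftCenter 𝕜 L)) :
    SZ 𝕜 L ⊗[𝕜] L :=
  if h : ∃ u, ∀ x, phi 𝕜 L u x = ω (es ++ [x]) fs then h.choose else 0

open Classical in
/-- The linear map `z ↦ ω(es; z, fs)`, and `0` if this is not linear. -/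
noncomputable def headMap (ω : PreCochain 𝕜 L) (es : List L) (fs : List (leftCenter 𝕜 L)) :
    leftCenter 𝕜 L →ₗ[𝕜] SZ 𝕜 L :=
  if h : IsLinearMap 𝕜 (fun z => ω es (z :: fs)) then h.mk' else 0

/-- The bracket `poisson` of functions regarded as cochains of degrees `n` and `m`, without reference
to representability. -/
noncomputable def bracketFun (n m : ℤ) (ω η : PreCochain 𝕜 L) : PreCochain 𝕜 L := fun es fs =>
  sgn (m - 1) • shuffleSum (fun a c b d => form 𝕜 L (lift ω a c) (lift η b d)) es fs
    + shuffleSum (fun a c b d => derivExt 𝕜 (headMap ω a d) (η b c)) es fs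
    - sgn (n * m) • shuffleSum (fun a c b d => derivExt 𝕜 (headMap η a d) (ω b c)) es fs

section

variable {n m : ℤ} {ω η : PreCochain 𝕜 L}

theorem phi_lift (h : ω ∈ Ctilde 𝕜 L n) (es : List L) (fs : List (leftCenter 𝕜 L)) (x : L) :
    phi 𝕜 L (lift ω es fs) x = ω (es ++ [x]) fs := by
  rw [lift, dif_pos (exists_phi h es fs)]
  exact (exists_phi h es fs).choose_spec x

theorem headMap_apply (h : ω ∈ Ctilde 𝕜 L n) (es : List L) (fs : List (leftCenter 𝕜 L))
    (z : leftCenter 𝕜 L) : headMap ω es fs z = ω es (z :: fs) := by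
  have hl : IsLinearMap 𝕜 (fun z => ω es (z :: fs)) :=
    (headZ ⟨ω, Ctilde_le 𝕜 L n h⟩ es fs).isLinear
  rw [headMap, dif_pos hl]
  rfl

theorem poisson_eq (ω : Ctilde 𝕜 L n) (η : Ctilde 𝕜 L m) :
    poisson ω η = bracketFun n m ω.1 η.1 := by
  have h1 : ∀ {n : ℤ} (ω : Ctilde 𝕜 L n) es fs, phi 𝕜 L (tilde ω es fs) =
      phi 𝕜 L (lift ω.1 es fs) := by
    intro n ω es fs
    ext x
    rw [phi_lift ω.2, phi_tilde]
    rfl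
  have h2 : ∀ {n : ℤ} (ω : Ctilde 𝕜 L n) es fs, headZ (toC ω) es fs = headMap ω.1 es fs := by
    intro n ω es fs
    ext x
    rw [headMap_apply ω.2]
    rfl
  have h3 : ∀ a c b d, form 𝕜 L (tilde ω a c) (tilde η b d) =
      form 𝕜 L (lift ω.1 a c) (lift η.1 b d) :=
    fun a c b d => form_congr 𝕜 (h1 ω a c) (h1 η b d)
  funext es fs
  simp only [poisson, Pi.sub_apply, Pi.add_apply, Pi.smul_apply, bullet, diamond, h2, h3]
  rfl

theorem bracketFun_nil (n m : ℤ) (ω η : PreCochain 𝕜 L) : bracketFun n m ω η [] [] =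
    sgn (m - 1) • form 𝕜 L (lift ω [] []) (lift η [] []) +
      derivExt 𝕜 (headMap ω [] []) (η [] []) -
      sgn (n * m) • derivExt 𝕜 (headMap η [] []) (ω [] []) := by
  simp [bracketFun]

theorem sign_smul_form_lift (h : ω ∈ Ctilde 𝕜 L n) (es : List L)
    (fs : List (leftCenter 𝕜 L)) (v : SZ 𝕜 L ⊗[𝕜] L) :
    (-1 : ℤ) ^ es.length • form 𝕜 L (lift ω es fs) v =
      sgn (n - 1) • form 𝕜 L (lift ω es fs) v := by
  by_cases hd : (es.length : ℤ) + 2 * fs.length = n - 1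
  · rw [neg_one_pow_eq_sgn hd]
  · rw [form_eq_zero, smul_zero, smul_zero]
    intro x
    rw [phi_lift h]
    exact apply_eq_zero h (by simp; omega)

theorem headMap_eq_zero (h : ω ∈ Ctilde 𝕜 L n) {es : List L} {fs : List (leftCenter 𝕜 L)}
    (hd : (es.length : ℤ) + 2 * fs.length ≠ n - 2) : headMap ω es fs = 0 := by
  ext z
  rw [headMap_apply h]
  exact apply_eq_zero h (by simp only [List.length_cons]; push_cast; omega)

theorem sign_smul_derivExt (h : ω ∈ Ctilde 𝕜 L n) (es : List L)
    (fs : List (leftCenter 𝕜 L)) (s : SZ 𝕜 L) :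
    (-1 : ℤ) ^ es.length • derivExt 𝕜 (headMap ω es fs) s =
      sgn n • derivExt 𝕜 (headMap ω es fs) s := by
  by_cases hd : (es.length : ℤ) + 2 * fs.length = n - 2
  · rw [neg_one_pow_eq_sgn hd, sgn_sub, sgn_two, mul_one]
  · rw [headMap_eq_zero h hd]; simp

theorem lift_contractZ (z : leftCenter 𝕜 L) (es : List L) (fs : List (leftCenter 𝕜 L)) :
    lift (contractZ z ω) es fs = lift ω es (z :: fs) := rfl

/-- Unlike the analogous facts for `ι_x` and for `lift`, this one needs the symmetry in the arguments
from `Z`. -/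
theorem headMap_contractZ (h : ω ∈ Ctilde 𝕜 L n) (z : leftCenter 𝕜 L) (es : List L)
    (fs : List (leftCenter 𝕜 L)) : headMap (contractZ z ω) es fs = headMap ω es (z :: fs) := by
  ext y
  rw [headMap_apply h, headMap_apply (contractZ_mem h z)]
  exact congrFun (congrFun (contractZ_comm h y z) es) fs

/-- `ι_x` is an odd derivation of the bracket. -/
theorem contractL_bracketFun (hω : ω ∈ Ctilde 𝕜 L n) (hη : η ∈ Ctilde 𝕜 L m) (x : L) :
    contractL 𝕜 x (bracketFun n m ω η) = bracketFun (n - 1) m (contractL 𝕜 x ω) η +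
      sgn n • bracketFun n (m - 1) ω (contractL 𝕜 x η) := by
  funext es fs
  simp only [contractL_apply, bracketFun, shuffleSum_cons_left, sign_smul_form_lift hω,
    sign_smul_derivExt hω, sign_smul_derivExt hη, shuffleSum_smul, Pi.add_apply, Pi.smul_apply]
  have h1 : ∀ (ω : PreCochain 𝕜 L) a c, lift ω (x :: a) c = lift (contractL 𝕜 x ω) a c :=
    fun _ _ _ => rfl
  have h2 : ∀ (ω : PreCochain 𝕜 L) a c, headMap ω (x :: a) c = headMap (contractL 𝕜 x ω) a c :=
    fun _ _ _ => rfl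
  have h3 : ∀ (ω : PreCochain 𝕜 L) a c, ω (x :: a) c = contractL 𝕜 x ω a c :=
    fun _ _ _ => rfl
  simp only [h1, h2, h3]
  rcases sgn_cases n with h | h <;> rcases sgn_cases m with h' | h' <;>
      simp only [sgn_sub, sgn_one, h.1, h.2, h'.1, h'.2] <;> module

/-- `ι_z` is a derivation of the bracket. -/
theorem contractZ_bracketFun (hω : ω ∈ Ctilde 𝕜 L n) (hη : η ∈ Ctilde 𝕜 L m)
    (z : leftCenter 𝕜 L) :
    contractZ z (bracketFun n m ω η) = bracketFun (n - 2) m (contractZ z ω) η +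
      bracketFun n (m - 2) ω (contractZ z η) := by
  funext es fs
  simp only [contractZ_apply, bracketFun, shuffleSum_cons_right, Pi.add_apply,
    headMap_contractZ hω, headMap_contractZ hη, lift_contractZ]
  rcases sgn_cases n with h | h <;> rcases sgn_cases m with h' | h' <;>
      simp only [sgn_sub, sgn_one, sgn_two, h.1, h.2, h'.1, h'.2] <;> module

/-- The bracket has degree `-2`, for empty argument lists. -/
theorem bracketFun_nil_eq_zero (hω : ω ∈ Ctilde 𝕜 L n) (hη : η ∈ Ctilde 𝕜 L m)
    (h : n + m - 2 ≠ 0) : bracketFun n m ω η [] [] = 0 := by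
  have h1 : form 𝕜 L (lift ω [] []) (lift η [] []) = 0 := by
    by_cases hn : n = 1
    · rw [form_symm]
      refine form_eq_zero (fun x => ?_) _
      rw [phi_lift hη]
      exact apply_eq_zero hη (by simp; omega)
    · refine form_eq_zero (fun x => ?_) _
      rw [phi_lift hω]
      exact apply_eq_zero hω (by simp; omega)
  have h2 : ∀ {n m : ℤ} {ω η : PreCochain 𝕜 L}, ω ∈ Ctilde 𝕜 L n → η ∈ Ctilde 𝕜 L m →
      n + m - 2 ≠ 0 → derivExt 𝕜 (headMap ω [] []) (η [] []) = 0 := by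
    intro n m ω η hω hη h
    by_cases hm : m = 0
    · rw [headMap_eq_zero hω (by simp; omega)]; simp
    · rw [apply_eq_zero hη (by simp; omega), map_zero]
  rw [bracketFun_nil, h1, h2 hω hη h, h2 hη hω (by omega)]
  simp

theorem headMap_add_smul {ω' : PreCochain 𝕜 L} (hω : ω ∈ Ctilde 𝕜 L n) (hω' : ω' ∈ Ctilde 𝕜 L n)
    (c : 𝕜) (es fs) : headMap (c • ω + ω') es fs = c • headMap ω es fs + headMap ω' es fs := by
  ext z
  simp [headMap_apply (add_mem (Submodule.smul_mem _ c hω) hω'), headMap_apply hω,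
    headMap_apply hω']

theorem form_lift_add_smul {ω' : PreCochain 𝕜 L} (hω : ω ∈ Ctilde 𝕜 L n)
    (hω' : ω' ∈ Ctilde 𝕜 L n) (c : 𝕜) (es fs) (v : SZ 𝕜 L ⊗[𝕜] L) :
    form 𝕜 L (lift (c • ω + ω') es fs) v =
      c • form 𝕜 L (lift ω es fs) v + form 𝕜 L (lift ω' es fs) v := by
  rw [form_congr 𝕜 (u' := c • lift ω es fs + lift ω' es fs) (v' := v) ?_ rfl]
  · simp
  · ext x
    simp [phi_lift (add_mem (Submodule.smul_mem _ c hω) hω'), phi_lift hω, phi_lift hω']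

theorem bracketFun_add_smul_left {ω' : PreCochain 𝕜 L} (hω : ω ∈ Ctilde 𝕜 L n)
    (hω' : ω' ∈ Ctilde 𝕜 L n) (c : 𝕜) (η : PreCochain 𝕜 L) :
    bracketFun n m (c • ω + ω') η = c • bracketFun n m ω η + bracketFun n m ω' η := by
  funext es fs
  simp only [bracketFun, form_lift_add_smul hω hω', headMap_add_smul hω hω', derivExt_add,
    derivExt_smul, Derivation.add_apply, Derivation.smul_apply, Pi.add_apply, Pi.smul_apply,
    map_add, Derivation.map_smul, shuffleSum_add, shuffleSum_smul]
  module

theorem bracketFun_add_smul_right {η' : PreCochain 𝕜 L} (hη : η ∈ Ctilde 𝕜 L m)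
    (hη' : η' ∈ Ctilde 𝕜 L m) (c : 𝕜) (ω : PreCochain 𝕜 L) :
    bracketFun n m ω (c • η + η') = c • bracketFun n m ω η + bracketFun n m ω η' := by
  funext es fs
  simp only [bracketFun, form_symm 𝕜 (lift ω _ _), form_lift_add_smul hη hη',
    headMap_add_smul hη hη', derivExt_add,
    derivExt_smul, Derivation.add_apply, Derivation.smul_apply, Pi.add_apply, Pi.smul_apply,
    map_add, Derivation.map_smul, shuffleSum_add, shuffleSum_smul]
  module

end

section

variable {n m : ℤ} {ω ω' η η' : PreCochain 𝕜 L}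

theorem bracketFun_add_left (hω : ω ∈ Ctilde 𝕜 L n) (hω' : ω' ∈ Ctilde 𝕜 L n) :
    bracketFun n m (ω + ω') η = bracketFun n m ω η + bracketFun n m ω' η := by
  simpa using bracketFun_add_smul_left hω hω' 1 η

theorem bracketFun_add_right (hη : η ∈ Ctilde 𝕜 L m) (hη' : η' ∈ Ctilde 𝕜 L m) :
    bracketFun n m ω (η + η') = bracketFun n m ω η + bracketFun n m ω η' := by
  simpa using bracketFun_add_smul_right hη hη' 1 ω

theorem bracketFun_zero_left : bracketFun n m 0 η = 0 := by
  simpa using bracketFun_add_left (m := m) (η := η) (Ctilde 𝕜 L n).zero_mem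
    (Ctilde 𝕜 L n).zero_mem

theorem bracketFun_zero_right : bracketFun n m ω 0 = 0 := by
  simpa using bracketFun_add_right (n := n) (ω := ω) (Ctilde 𝕜 L m).zero_mem
    (Ctilde 𝕜 L m).zero_mem

theorem bracketFun_smul_left (hω : ω ∈ Ctilde 𝕜 L n) (c : 𝕜) :
    bracketFun n m (c • ω) η = c • bracketFun n m ω η := by
  simpa [bracketFun_zero_left] using
    bracketFun_add_smul_left (m := m) hω (Ctilde 𝕜 L n).zero_mem c η

theorem bracketFun_smul_right (hη : η ∈ Ctilde 𝕜 L m) (c : 𝕜) :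
    bracketFun n m ω (c • η) = c • bracketFun n m ω η := by
  simpa [bracketFun_zero_right] using
    bracketFun_add_smul_right (n := n) hη (Ctilde 𝕜 L m).zero_mem c ω

theorem bracketFun_zsmul_left (hω : ω ∈ Ctilde 𝕜 L n) (c : ℤ) :
    bracketFun n m (c • ω) η = c • bracketFun n m ω η := by
  rw [← Int.cast_smul_eq_zsmul 𝕜, bracketFun_smul_left hω, Int.cast_smul_eq_zsmul]

theorem bracketFun_zsmul_right (hη : η ∈ Ctilde 𝕜 L m) (c : ℤ) :
    bracketFun n m ω (c • η) = c • bracketFun n m ω η := by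
  rw [← Int.cast_smul_eq_zsmul 𝕜, bracketFun_smul_right hη, Int.cast_smul_eq_zsmul]

theorem bracketFun_neg_left (hω : ω ∈ Ctilde 𝕜 L n) :
    bracketFun n m (-ω) η = -bracketFun n m ω η := by
  simpa using bracketFun_zsmul_left (m := m) (η := η) hω (-1)

theorem bracketFun_neg_right (hη : η ∈ Ctilde 𝕜 L m) :
    bracketFun n m ω (-η) = -bracketFun n m ω η := by
  simpa using bracketFun_zsmul_right (n := n) (ω := ω) hη (-1)

/-! ### Antisymmetry and closure -/

theorem bracketFun_antisymm (hω : ω ∈ Ctilde 𝕜 L n) (hη : η ∈ Ctilde 𝕜 L m) :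
    bracketFun n m ω η = -(sgn (n * m) • bracketFun m n η ω) := by
  rw [eq_neg_iff_add_eq_zero]
  set G : Set (PreCochain 𝕜 L) := {δ | ∃ (n m : ℤ) (ω η : PreCochain 𝕜 L),
    ω ∈ Ctilde 𝕜 L n ∧ η ∈ Ctilde 𝕜 L m ∧
    δ = bracketFun n m ω η + sgn (n * m) • bracketFun m n η ω} with hG
  have h1 := Submodule.subset_span (R := 𝕜) (s := G)
  refine eq_zero_of_contractions G ?_ ?_ ?_ _ ⟨n, m, ω, η, hω, hη, rfl⟩
  · rintro _ ⟨n, m, ω, η, hω, hη, rfl⟩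
    simp only [Pi.add_apply, Pi.smul_apply]
    by_cases hnm : n + m - 2 = 0
    · obtain rfl : m = 2 - n := by omega
      rw [bracketFun_nil, bracketFun_nil, form_symm]
      rcases sgn_cases n with h | h
      · -- the degrees are even, so that no cochain has a linear part
        rw [form_eq_zero]
        · rw [mul_comm (2 - n)]
          simp only [h.2]
          module
        · intro x
          rw [phi_lift hη]
          refine apply_eq_zero hη ?_
          rintro h'
          obtain rfl : n = 1 := by simp at h'; omega
          simp [sgn_one] at h
      · rw [mul_comm (2 - n)]
        simp only [h.2, sgn_sub, h.1, sgn_one, sgn_two]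
        module
    · rw [bracketFun_nil_eq_zero hω hη hnm, bracketFun_nil_eq_zero hη hω (by omega)]
      simp
  · rintro _ ⟨n, m, ω, η, hω, hη, rfl⟩ x
    convert add_mem (h1 ⟨_, _, _, _, contractL_mem hω x, hη, rfl⟩)
      (zsmul_mem (h1 ⟨_, _, _, _, hω, contractL_mem hη x, rfl⟩) (sgn n)) using 1
    simp only [map_add, map_zsmul, contractL_bracketFun hω hη, contractL_bracketFun hη hω]
    rcases sgn_cases n with h | h <;> rcases sgn_cases m with h' | h' <;>
      simp only [sgn_sub, sgn_one, h.1, h.2, h'.1, h'.2] <;> module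
  · rintro _ ⟨n, m, ω, η, hω, hη, rfl⟩ z
    convert add_mem (h1 ⟨_, _, _, _, contractZ_mem hω z, hη, rfl⟩)
      (h1 ⟨_, _, _, _, hω, contractZ_mem hη z, rfl⟩) using 1
    simp only [map_add, map_zsmul, contractZ_bracketFun hω hη, contractZ_bracketFun hη hω]
    rcases sgn_cases n with h | h <;> rcases sgn_cases m with h' | h' <;>
      simp only [sgn_sub, sgn_two, h.1, h.2, h'.1, h'.2] <;> module

end

variable {n m l k : ℤ} {ω ω' η μ : PreCochain 𝕜 L}

/-- Representability of the bracket with a cochain of degree `1`: if `ω` has degree `2` and `η` is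
given by `v`, the contributions `ω(; (x, y))` of the two halves of the bracket cancel. -/
theorem exists_phi_form_add_derivExt (hω : ω ∈ Ctilde 𝕜 L n) (v : SZ 𝕜 L ⊗[𝕜] L) :
    ∃ u, ∀ x, phi 𝕜 L u x = form 𝕜 L (lift (contractL 𝕜 x ω) [] []) v +
      derivExt 𝕜 (headMap ω [] []) (phi 𝕜 L v x) := by
  induction v with
  | zero => exact ⟨0, by simp⟩
  | add a b ha hb =>
    obtain ⟨u, hu⟩ := ha
    obtain ⟨v, hv⟩ := hb
    exact ⟨u + v, fun x => by simp [hu, hv]; abel⟩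
  | tmul t y =>
    obtain ⟨u, hu⟩ := exists_phi hω [y] []
    refine ⟨derivExt 𝕜 (headMap ω [] []) t ⊗ₜ y - t • u, fun x => ?_⟩
    have h := congrFun (congrFun (contractL_skew hω y x) []) []
    simp only [Pi.add_apply, Pi.neg_apply, contractL_apply, contractZ_apply] at h
    rw [form_tmul_right, phi_lift (contractL_mem hω x), phi_tmul, Derivation.leibniz, derivExt_ι,
      headMap_apply hω, map_sub, LinearMap.sub_apply, phi_smul, hu, phi_tmul, contractL_apply]
    simp only [smul_eq_mul, List.cons_append, List.nil_append]
    linear_combination -t * h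

/-- Up to antisymmetry, these are the degrees for which the bracket has degree `1`. -/
theorem exists_phi_bracketFun_of_le (hω : ω ∈ Ctilde 𝕜 L n) (hη : η ∈ Ctilde 𝕜 L m)
    (h : n + m = 3) (hm : m ≤ 1) : ∃ u, ∀ x, phi 𝕜 L u x = bracketFun n m ω η [x] [] := by
  have key : ∀ x, bracketFun n m ω η [x] [] = bracketFun (n - 1) m (contractL 𝕜 x ω) η [] [] +
      sgn n • bracketFun n (m - 1) ω (contractL 𝕜 x η) [] [] := fun x =>
    congrFun (congrFun (contractL_bracketFun hω hη x) []) []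
  rcases lt_trichotomy m 0 with hm0 | rfl | hm0
  · rw [eq_zero_of_neg hη hm0, bracketFun_zero_right]
    exact ⟨0, by simp⟩
  · obtain rfl : n = 3 := by omega
    obtain ⟨u, hu⟩ := exists_phi_derivation
      (fun x => derivExt 𝕜 (headMap (contractL 𝕜 x ω) [] [])) (fun z => by
        obtain ⟨u, hu⟩ := exists_phi hω [] [z]
        exact ⟨u, fun x => by
          rw [hu, derivExt_ι, headMap_apply (contractL_mem hω x)]; rfl⟩) (η [] [])
    refine ⟨u, fun x => ?_⟩
    rw [hu, key, eq_zero_of_neg (contractL_mem hη x) (by norm_num), bracketFun_zero_right,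
      bracketFun_nil, form_symm, form_eq_zero, headMap_eq_zero hη (by simp)]
    · simp
    · intro y
      rw [phi_lift hη]
      exact apply_eq_zero hη (by simp)
  · obtain rfl : m = 1 := by omega
    obtain rfl : n = 2 := by omega
    obtain ⟨u, hu⟩ := exists_phi_form_add_derivExt hω (lift η [] [])
    refine ⟨u, fun x => ?_⟩
    rw [hu, key, bracketFun_nil, bracketFun_nil, form_eq_zero (u := lift ω [] []),
      headMap_eq_zero hη (by simp), headMap_eq_zero (contractL_mem hη x) (by simp),
      apply_eq_zero hη (es := []) (fs := []) (by simp), phi_lift hη]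
    · simp [sgn_zero, sgn_two, contractL_apply]
    · intro y
      rw [phi_lift hω]
      exact apply_eq_zero hω (by simp)

theorem exists_phi_bracketFun (hω : ω ∈ Ctilde 𝕜 L n) (hη : η ∈ Ctilde 𝕜 L m) :
    ∃ u, ∀ x, phi 𝕜 L u x = bracketFun n m ω η [x] [] := by
  by_cases h : n + m = 3
  · by_cases hm : m ≤ 1
    · exact exists_phi_bracketFun_of_le hω hη h hm
    · obtain ⟨u, hu⟩ := exists_phi_bracketFun_of_le hη hω (by omega) (by omega)
      refine ⟨-(sgn (n * m) • u), fun x => ?_⟩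
      rw [bracketFun_antisymm hω hη]
      simp [hu]
  · refine ⟨0, fun x => ?_⟩
    have := congrFun (congrFun (contractL_bracketFun hω hη x) []) []
    rw [contractL_apply] at this
    rw [this, Pi.add_apply, Pi.add_apply, Pi.smul_apply, Pi.smul_apply,
      bracketFun_nil_eq_zero (contractL_mem hω x) hη (by omega),
      bracketFun_nil_eq_zero hω (contractL_mem hη x) (by omega)]
    simp

theorem bracketFun_mem (hω : ω ∈ Ctilde 𝕜 L n) (hη : η ∈ Ctilde 𝕜 L m) (hk : n + m - 2 = k) :
    bracketFun n m ω η ∈ Ctilde 𝕜 L k := by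
  refine mem_Ctilde_of_contractions (fun k => {μ | ∃ (n m : ℤ) (ω η : PreCochain 𝕜 L),
    ω ∈ Ctilde 𝕜 L n ∧ η ∈ Ctilde 𝕜 L m ∧ n + m - 2 = k ∧ μ = bracketFun n m ω η}) ?_ ?_ ?_
    ⟨n, m, ω, η, hω, hη, hk, rfl⟩
  · rintro k _ ⟨n, m, ω, η, hω, hη, hk, rfl⟩
    refine ⟨fun hk0 => bracketFun_nil_eq_zero hω hη (by omega), exists_phi_bracketFun hω hη,
      fun c x y => ?_, fun c x y => ?_, fun x y => ?_, fun x y => ?_⟩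
    · simp only [contractL_bracketFun hω hη, contractL_add_smul hω, contractL_add_smul hη]
      rw [bracketFun_add_smul_left (contractL_mem hω x) (contractL_mem hω y),
        bracketFun_add_smul_right (contractL_mem hη x) (contractL_mem hη y)]
      module
    · simp only [contractZ_bracketFun hω hη, contractZ_add_smul hω, contractZ_add_smul hη]
      rw [bracketFun_add_smul_left (contractZ_mem hω x) (contractZ_mem hω y),
        bracketFun_add_smul_right (contractZ_mem hη x) (contractZ_mem hη y)]
      module
    · simp only [contractZ_bracketFun hω hη, map_add,
        contractZ_bracketFun (contractZ_mem hω _) hη, contractZ_bracketFun hω (contractZ_mem hη _),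
        contractZ_comm hω x y, contractZ_comm hη x y]
      abel
    · have h1 := congrArg (bracketFun (n - 1 - 1) m · η) (contractL_skew hω x y)
      have h2 := congrArg (bracketFun n (m - 1 - 1) ω) (contractL_skew hη x y)
      have e : ∀ a : ℤ, a - 2 = a - 1 - 1 := fun a => by ring
      have hz : contractZ (pair 𝕜 L x y) ω ∈ Ctilde 𝕜 L (n - 1 - 1) := by
        rw [← e]; exact contractZ_mem hω _
      have hz' : contractZ (pair 𝕜 L x y) η ∈ Ctilde 𝕜 L (m - 1 - 1) := by
        rw [← e]; exact contractZ_mem hη _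
      beta_reduce at h1
      rw [bracketFun_add_left (contractL_mem (contractL_mem hω x) y)
        (contractL_mem (contractL_mem hω y) x), bracketFun_neg_left hz] at h1
      rw [bracketFun_add_right (contractL_mem (contractL_mem hη x) y)
        (contractL_mem (contractL_mem hη y) x), bracketFun_neg_right hz'] at h2
      simp only [contractL_bracketFun hω hη, contractZ_bracketFun hω hη, map_add, map_zsmul,
        contractL_bracketFun (contractL_mem hω _) hη, contractL_bracketFun hω (contractL_mem hη _),
        e]
      rcases sgn_cases n with h | h <;> simp only [sgn_sub, sgn_one, h.1] <;>
        linear_combination (norm := module) h1 + h2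
  · rintro k _ ⟨n, m, ω, η, hω, hη, hk, rfl⟩ x
    rw [contractL_bracketFun hω hη]
    refine Submodule.add_mem _
      (Submodule.subset_span ⟨_, _, _, _, contractL_mem hω x, hη, by omega, rfl⟩)
      (Submodule.smul_of_tower_mem _ _
        (Submodule.subset_span ⟨_, _, _, _, hω, contractL_mem hη x, by omega, rfl⟩))
  · rintro k _ ⟨n, m, ω, η, hω, hη, hk, rfl⟩ x
    rw [contractZ_bracketFun hω hη]
    refine Submodule.add_mem _
      (Submodule.subset_span ⟨_, _, _, _, contractZ_mem hω x, hη, by omega, rfl⟩)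
      (Submodule.subset_span ⟨_, _, _, _, hω, contractZ_mem hη x, by omega, rfl⟩)

/-! ### The Leibniz rule -/

theorem form_lift_mul (hη : η ∈ Ctilde 𝕜 L m) (hμ : μ ∈ Ctilde 𝕜 L l) (u : SZ 𝕜 L ⊗[𝕜] L) :
    form 𝕜 L u (lift (mulLin 𝕜 L η μ) [] []) =
      μ [] [] * form 𝕜 L u (lift η [] []) + η [] [] * form 𝕜 L u (lift μ [] []) := by
  rw [form_symm, form_congr 𝕜
    (u' := μ [] [] • lift η [] [] + η [] [] • lift μ [] []) (v' := u) ?_ rfl]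
  · simp only [map_add, LinearMap.add_apply, form_smul_left, form_symm 𝕜 u]
  · ext x
    simp only [map_add, LinearMap.add_apply, phi_smul, phi_lift hη, phi_lift hμ,
      phi_lift (mul_mem hη hμ rfl), List.nil_append]
    rw [mulLin_apply, shuffleSum_cons_left, shuffleSum_nil, shuffleSum_nil]
    simp [mul_comm]

theorem derivExt_headMap_mul (hη : η ∈ Ctilde 𝕜 L m) (hμ : μ ∈ Ctilde 𝕜 L l) :
    derivExt 𝕜 (headMap (mulLin 𝕜 L η μ) [] []) =
      μ [] [] • derivExt 𝕜 (headMap η [] []) + η [] [] • derivExt 𝕜 (headMap μ [] []) := by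
  rw [← derivExt_mul_smul, ← derivExt_mul_smul, ← derivExt_add]
  congr 1
  ext z
  simp only [LinearMap.add_apply, LinearMap.smul_apply, headMap_apply hη, headMap_apply hμ,
      headMap_apply (mul_mem hη hμ rfl), smul_eq_mul]
  rw [mulLin_apply, shuffleSum_cons_right, shuffleSum_nil, shuffleSum_nil, mul_comm]

/-- The defect of the Leibniz rule. -/
noncomputable def leibnizDefect (n m l : ℤ) (ω η μ : PreCochain 𝕜 L) : PreCochain 𝕜 L :=
  bracketFun n (m + l) ω (mulLin 𝕜 L η μ) - (mulLin 𝕜 L (bracketFun n m ω η) μ +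
    sgn (n * m) • mulLin 𝕜 L η (bracketFun n l ω μ))

theorem contractL_leibnizDefect (hω : ω ∈ Ctilde 𝕜 L n) (hη : η ∈ Ctilde 𝕜 L m)
    (hμ : μ ∈ Ctilde 𝕜 L l) (x : L) : contractL 𝕜 x (leibnizDefect n m l ω η μ) =
      leibnizDefect (n - 1) m l (contractL 𝕜 x ω) η μ +
        sgn n • leibnizDefect n (m - 1) l ω (contractL 𝕜 x η) μ +
        sgn (n + m) • leibnizDefect n m (l - 1) ω η (contractL 𝕜 x μ) := by
  have e : m - 1 + l = m + l - 1 := by ring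
  have e' : m + (l - 1) = m + l - 1 := by ring
  have hm1 : mulLin 𝕜 L (contractL 𝕜 x η) μ ∈ Ctilde 𝕜 L (m + l - 1) :=
    mul_mem (contractL_mem hη x) hμ e
  have hm2 : mulLin 𝕜 L η (contractL 𝕜 x μ) ∈ Ctilde 𝕜 L (m + l - 1) :=
    mul_mem hη (contractL_mem hμ x) e'
  unfold leibnizDefect
  rw [map_sub, contractL_bracketFun hω (mul_mem hη hμ rfl), contractL_mul hη,
    bracketFun_add_right hm1 (zsmul_mem hm2 _), bracketFun_zsmul_right hm2, map_add, map_zsmul,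
    contractL_mul (bracketFun_mem hω hη rfl), contractL_mul hη, contractL_bracketFun hω hη,
    contractL_bracketFun hω hμ, e, e']
  simp only [map_add, map_zsmul, LinearMap.add_apply, LinearMap.smul_apply]
  rcases sgn_cases n with h | h <;> rcases sgn_cases m with h' | h' <;>
    simp only [sgn_sub, sgn_add, sgn_one, sgn_two, h.1, h.2, h'.1, h'.2] <;> module

theorem contractZ_leibnizDefect (hω : ω ∈ Ctilde 𝕜 L n) (hη : η ∈ Ctilde 𝕜 L m)
    (hμ : μ ∈ Ctilde 𝕜 L l) (z : leftCenter 𝕜 L) : contractZ z (leibnizDefect n m l ω η μ) =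
      leibnizDefect (n - 2) m l (contractZ z ω) η μ +
        leibnizDefect n (m - 2) l ω (contractZ z η) μ +
        leibnizDefect n m (l - 2) ω η (contractZ z μ) := by
  have e : m - 2 + l = m + l - 2 := by ring
  have e' : m + (l - 2) = m + l - 2 := by ring
  have hm1 : mulLin 𝕜 L (contractZ z η) μ ∈ Ctilde 𝕜 L (m + l - 2) :=
    mul_mem (contractZ_mem hη z) hμ e
  have hm2 : mulLin 𝕜 L η (contractZ z μ) ∈ Ctilde 𝕜 L (m + l - 2) :=
    mul_mem hη (contractZ_mem hμ z) e'
  unfold leibnizDefect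
  rw [map_sub, contractZ_bracketFun hω (mul_mem hη hμ rfl), contractZ_mul,
    bracketFun_add_right hm1 hm2, map_add, map_zsmul,
    contractZ_mul, contractZ_mul, contractZ_bracketFun hω hη,
    contractZ_bracketFun hω hμ, e, e']
  simp only [map_add, LinearMap.add_apply]
  rcases sgn_cases n with h | h <;> rcases sgn_cases m with h' | h' <;>
    simp only [sgn_sub, sgn_two, h.1, h.2, h'.1, h'.2] <;> module

theorem leibnizDefect_nil (hη : η ∈ Ctilde 𝕜 L m) (hμ : μ ∈ Ctilde 𝕜 L l) :
    leibnizDefect n m l ω η μ [] [] = 0 := by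
  simp only [leibnizDefect, Pi.sub_apply, Pi.add_apply, Pi.smul_apply, mulLin_nil, bracketFun_nil,
    form_lift_mul hη hμ, derivExt_headMap_mul hη hμ, Derivation.leibniz, smul_eq_mul,
    Derivation.add_apply, Derivation.smul_apply]
  by_cases hl : l = 0 <;> by_cases hm : m = 0
  · subst hl hm
    simp [sgn_zero]; ring
  · subst hl
    simp only [apply_eq_zero hη (es := []) (fs := []) (by simpa using Ne.symm hm)]
    simp; ring
  · subst hm
    simp only [apply_eq_zero hμ (es := []) (fs := []) (by simpa using Ne.symm hl)]
    simp [sgn_zero]; ring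
  · simp [apply_eq_zero hη (es := []) (fs := []) (by simpa using Ne.symm hm),
      apply_eq_zero hμ (es := []) (fs := []) (by simpa using Ne.symm hl)]

theorem bracketFun_mul (hω : ω ∈ Ctilde 𝕜 L n) (hη : η ∈ Ctilde 𝕜 L m) (hμ : μ ∈ Ctilde 𝕜 L l)
    (hk : m + l = k) : bracketFun n k ω (mulLin 𝕜 L η μ) =
      mulLin 𝕜 L (bracketFun n m ω η) μ +
        sgn (n * m) • mulLin 𝕜 L η (bracketFun n l ω μ) := by
  subst hk
  rw [← sub_eq_zero]
  set G : Set (PreCochain 𝕜 L) := {δ | ∃ (n m l : ℤ) (ω η μ : PreCochain 𝕜 L),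
    ω ∈ Ctilde 𝕜 L n ∧ η ∈ Ctilde 𝕜 L m ∧ μ ∈ Ctilde 𝕜 L l ∧
    δ = leibnizDefect n m l ω η μ} with hG
  have h1 := Submodule.subset_span (R := 𝕜) (s := G)
  refine eq_zero_of_contractions G ?_ ?_ ?_ _ ⟨n, m, l, ω, η, μ, hω, hη, hμ, rfl⟩
  · rintro _ ⟨n, m, l, ω, η, μ, hω, hη, hμ, rfl⟩
    exact leibnizDefect_nil hη hμ
  · rintro _ ⟨n, m, l, ω, η, μ, hω, hη, hμ, rfl⟩ x
    rw [contractL_leibnizDefect hω hη hμ]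
    exact add_mem (add_mem (h1 ⟨_, _, _, _, _, _, contractL_mem hω x, hη, hμ, rfl⟩)
      (zsmul_mem (h1 ⟨_, _, _, _, _, _, hω, contractL_mem hη x, hμ, rfl⟩) (sgn n)))
      (zsmul_mem (h1 ⟨_, _, _, _, _, _, hω, hη, contractL_mem hμ x, rfl⟩) (sgn (n + m)))
  · rintro _ ⟨n, m, l, ω, η, μ, hω, hη, hμ, rfl⟩ x
    rw [contractZ_leibnizDefect hω hη hμ]
    exact add_mem (add_mem (h1 ⟨_, _, _, _, _, _, contractZ_mem hω x, hη, hμ, rfl⟩)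
      (h1 ⟨_, _, _, _, _, _, hω, contractZ_mem hη x, hμ, rfl⟩))
      (h1 ⟨_, _, _, _, _, _, hω, hη, contractZ_mem hμ x, rfl⟩)

theorem mul_bracketFun (hω : ω ∈ Ctilde 𝕜 L n) (hη : η ∈ Ctilde 𝕜 L m) (hμ : μ ∈ Ctilde 𝕜 L l)
    (hk : n + m = k) : bracketFun k l (mulLin 𝕜 L ω η) μ =
      mulLin 𝕜 L ω (bracketFun m l η μ) +
        sgn (m * l) • mulLin 𝕜 L (bracketFun n l ω μ) η := by
  subst hk
  rw [bracketFun_antisymm (mul_mem hω hη rfl) hμ, bracketFun_mul hμ hω hη rfl,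
    bracketFun_antisymm hη hμ, bracketFun_antisymm hω hμ]
  simp only [map_neg, map_zsmul, LinearMap.neg_apply, LinearMap.smul_apply]
  rcases sgn_cases n with h | h <;> rcases sgn_cases l with h' | h' <;>
    simp only [sgn_add, h.1, h.2, h'.1, h'.2] <;> module

/-! ### Brackets with generators -/

theorem bracketFun_const_nil (ω : PreCochain 𝕜 L) (s : SZ 𝕜 L) :
    bracketFun 0 m (const s) ω [] [] = -derivExt 𝕜 (headMap ω [] []) s := by
  rw [bracketFun_nil, form_eq_zero, headMap_eq_zero (const_mem s) (by simp)]
  · simp [sgn_zero]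
  · intro x
    rw [phi_lift (const_mem s)]
    rfl

/-- Scalars are central for the bracket. -/
theorem bracketFun_const_algebraMap (hω : ω ∈ Ctilde 𝕜 L m) (r : 𝕜) :
    bracketFun 0 m (const (algebraMap 𝕜 _ r)) ω = 0 := by
  set G : Set (PreCochain 𝕜 L) := {δ | ∃ (m : ℤ) (ω : PreCochain 𝕜 L),
    ω ∈ Ctilde 𝕜 L m ∧ δ = bracketFun 0 m (const (algebraMap 𝕜 _ r)) ω} with hG
  have h1 := Submodule.subset_span (R := 𝕜) (s := G)
  refine eq_zero_of_contractions G ?_ ?_ ?_ _ ⟨m, ω, hω, rfl⟩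
  · rintro _ ⟨m, ω, hω, rfl⟩
    rw [bracketFun_const_nil]
    simp
  · rintro _ ⟨m, ω, hω, rfl⟩ x
    rw [contractL_bracketFun (const_mem _) hω, contractL_const, bracketFun_zero_left, zero_add]
    exact zsmul_mem (h1 ⟨_, _, contractL_mem hω x, rfl⟩) _
  · rintro _ ⟨m, ω, hω, rfl⟩ x
    rw [contractZ_bracketFun (const_mem _) hω, contractZ_const, bracketFun_zero_left, zero_add]
    exact h1 ⟨_, _, contractZ_mem hω x, rfl⟩

/-- The bracket with `z ∈ Z` is the contraction `-ι_z`. -/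
theorem bracketFun_const_ι (hω : ω ∈ Ctilde 𝕜 L m) (z : leftCenter 𝕜 L) :
    bracketFun 0 m (const (SymmetricAlgebra.ι 𝕜 _ z)) ω = -contractZ z ω := by
  rw [← sub_eq_zero]
  set G : Set (PreCochain 𝕜 L) := {δ | ∃ (m : ℤ) (ω : PreCochain 𝕜 L),
    ω ∈ Ctilde 𝕜 L m ∧
    δ = bracketFun 0 m (const (SymmetricAlgebra.ι 𝕜 _ z)) ω - -contractZ z ω} with hG
  have h1 := Submodule.subset_span (R := 𝕜) (s := G)
  refine eq_zero_of_contractions G ?_ ?_ ?_ _ ⟨m, ω, hω, rfl⟩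
  · rintro _ ⟨m, ω, hω, rfl⟩
    rw [Pi.sub_apply, Pi.sub_apply, bracketFun_const_nil]
    simp [headMap_apply hω, contractZ_apply]
  · rintro _ ⟨m, ω, hω, rfl⟩ x
    rw [map_sub, contractL_bracketFun (const_mem _) hω, contractL_const, bracketFun_zero_left,
      zero_add, sgn_zero, one_smul, map_neg, ← contractZ_contractL]
    exact h1 ⟨_, _, contractL_mem hω x, rfl⟩
  · rintro _ ⟨m, ω, hω, rfl⟩ x
    rw [map_sub, contractZ_bracketFun (const_mem _) hω, contractZ_const, bracketFun_zero_left,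
      zero_add, map_neg, contractZ_comm hω]
    exact h1 ⟨_, _, contractZ_mem hω x, rfl⟩

/-- The bracket with the linear form `(e, ·)` is the contraction `ι_e`. -/
theorem bracketFun_linearCochain (hω : ω ∈ Ctilde 𝕜 L m) (e : L) :
    bracketFun 1 m (linearCochain (1 ⊗ₜ e)) ω = contractL 𝕜 e ω := by
  rw [← sub_eq_zero]
  set G : Set (PreCochain 𝕜 L) := {δ | ∃ (m : ℤ) (ω : PreCochain 𝕜 L),
    ω ∈ Ctilde 𝕜 L m ∧
    δ = bracketFun 1 m (linearCochain (1 ⊗ₜ e)) ω - contractL 𝕜 e ω} with hG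
  have h1 := Submodule.subset_span (R := 𝕜) (s := G)
  refine eq_zero_of_contractions G ?_ ?_ ?_ _ ⟨m, ω, hω, rfl⟩
  · rintro _ ⟨m, ω, hω, rfl⟩
    rw [Pi.sub_apply, Pi.sub_apply, bracketFun_nil, form_symm,
      form_congr 𝕜 (u' := lift ω [] []) (v' := 1 ⊗ₜ e) rfl, form_tmul_right, one_mul, phi_lift hω,
      headMap_eq_zero (linearCochain_mem _) (by simp),
      apply_eq_zero (linearCochain_mem _) (es := []) (fs := []) (by simp), contractL_apply]
    · by_cases hm : m = 1
      · subst hm; simp [sgn_zero]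
      · simp [apply_eq_zero hω (es := [e]) (fs := []) (by simpa using Ne.symm hm)]
    · ext x
      rw [phi_lift (linearCochain_mem _)]
      rfl
  · rintro _ ⟨m, ω, hω, rfl⟩ x
    rw [map_sub, contractL_bracketFun (linearCochain_mem _) hω, contractL_linearCochain, phi_tmul,
      one_mul, sub_self, bracketFun_const_ι hω]
    convert neg_mem (h1 ⟨_, _, contractL_mem hω x, rfl⟩) using 1
    have h2 := contractL_skew hω e x
    rw [sgn_one]
    linear_combination (norm := module) -h2
  · rintro _ ⟨m, ω, hω, rfl⟩ x
    rw [map_sub, contractZ_bracketFun (linearCochain_mem _) hω, contractZ_linearCochain,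
      bracketFun_zero_left, zero_add, contractZ_contractL]
    exact h1 ⟨_, _, contractZ_mem hω x, rfl⟩

/-! ### The Jacobi identity -/

/-- The defect of the Jacobi identity. -/
noncomputable def jacobiator (n m l : ℤ) (ω η μ : PreCochain 𝕜 L) : PreCochain 𝕜 L :=
  bracketFun n (m + l - 2) ω (bracketFun m l η μ) - bracketFun (n + m - 2) l (bracketFun n m ω η) μ
    - sgn (n * m) • bracketFun m (n + l - 2) η (bracketFun n l ω μ)

theorem jacobiator_swap_left (hω : ω ∈ Ctilde 𝕜 L n) (hη : η ∈ Ctilde 𝕜 L m) :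
    jacobiator n m l ω η μ = -(sgn (n * m) • jacobiator m n l η ω μ) := by
  unfold jacobiator
  have h : bracketFun m n η ω ∈ Ctilde 𝕜 L (n + m - 2) := bracketFun_mem hη hω (by ring)
  rw [bracketFun_antisymm hω hη, bracketFun_neg_left (zsmul_mem h _), bracketFun_zsmul_left h,
    add_comm m n]
  rcases sgn_cases n with h | h <;> rcases sgn_cases m with h' | h' <;>
    simp only [h.2, h'.1] <;> module

theorem jacobiator_swap_right (hω : ω ∈ Ctilde 𝕜 L n) (hη : η ∈ Ctilde 𝕜 L m)
    (hμ : μ ∈ Ctilde 𝕜 L l) :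
    jacobiator n m l ω η μ = -(sgn (m * l) • jacobiator n l m ω μ η) := by
  unfold jacobiator
  have h : bracketFun l m μ η ∈ Ctilde 𝕜 L (m + l - 2) := bracketFun_mem hμ hη (by ring)
  rw [bracketFun_antisymm hη hμ, bracketFun_neg_right (zsmul_mem h _), bracketFun_zsmul_right h,
    bracketFun_antisymm (bracketFun_mem hω hη rfl) hμ,
    bracketFun_antisymm (bracketFun_mem hω hμ rfl) hη, add_comm l m]
  rcases sgn_cases n with h | h <;> rcases sgn_cases m with h' | h' <;>
    rcases sgn_cases l with h'' | h'' <;>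
    simp only [sgn_add, sgn_sub, sgn_two, h.1, h.2, h'.1, h'.2, h''.1, h''.2] <;> module

theorem contractL_jacobiator (hω : ω ∈ Ctilde 𝕜 L n) (hη : η ∈ Ctilde 𝕜 L m)
    (hμ : μ ∈ Ctilde 𝕜 L l) (x : L) : contractL 𝕜 x (jacobiator n m l ω η μ) =
      jacobiator (n - 1) m l (contractL 𝕜 x ω) η μ +
        sgn n • jacobiator n (m - 1) l ω (contractL 𝕜 x η) μ +
        sgn (n + m) • jacobiator n m (l - 1) ω η (contractL 𝕜 x μ) := by
  have e : ∀ a b : ℤ, a - 1 + b - 2 = a + b - 2 - 1 := fun a b => by ring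
  have e' : ∀ a b : ℤ, a + (b - 1) - 2 = a + b - 2 - 1 := fun a b => by ring
  have hL : ∀ {n m ω η}, ω ∈ Ctilde 𝕜 L n → η ∈ Ctilde 𝕜 L m →
      bracketFun (n - 1) m (contractL 𝕜 x ω) η ∈ Ctilde 𝕜 L (n + m - 2 - 1) :=
    fun hω hη => bracketFun_mem (contractL_mem hω x) hη (e _ _)
  have hR : ∀ {n m ω η}, ω ∈ Ctilde 𝕜 L n → η ∈ Ctilde 𝕜 L m →
      bracketFun n (m - 1) ω (contractL 𝕜 x η) ∈ Ctilde 𝕜 L (n + m - 2 - 1) :=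
    fun hω hη => bracketFun_mem hω (contractL_mem hη x) (e' _ _)
  unfold jacobiator
  rw [map_sub, map_sub, map_zsmul, contractL_bracketFun hω (bracketFun_mem hη hμ rfl),
    contractL_bracketFun hη hμ, contractL_bracketFun (bracketFun_mem hω hη rfl) hμ,
    contractL_bracketFun hω hη, contractL_bracketFun hη (bracketFun_mem hω hμ rfl),
    contractL_bracketFun hω hμ,
    bracketFun_add_right (hL hη hμ) (zsmul_mem (hR hη hμ) _), bracketFun_zsmul_right (hR hη hμ),
    bracketFun_add_left (hL hω hη) (zsmul_mem (hR hω hη) _), bracketFun_zsmul_left (hR hω hη),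
    bracketFun_add_right (hL hω hμ) (zsmul_mem (hR hω hμ) _), bracketFun_zsmul_right (hR hω hμ)]
  simp only [e, e']
  rcases sgn_cases n with h | h <;> rcases sgn_cases m with h' | h' <;>
    simp only [sgn_sub, sgn_add, sgn_one, sgn_two, h.1, h.2, h'.1, h'.2] <;> module

theorem contractZ_jacobiator (hω : ω ∈ Ctilde 𝕜 L n) (hη : η ∈ Ctilde 𝕜 L m)
    (hμ : μ ∈ Ctilde 𝕜 L l) (z : leftCenter 𝕜 L) : contractZ z (jacobiator n m l ω η μ) =
      jacobiator (n - 2) m l (contractZ z ω) η μ +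
        jacobiator n (m - 2) l ω (contractZ z η) μ +
        jacobiator n m (l - 2) ω η (contractZ z μ) := by
  have e : ∀ a b : ℤ, a - 2 + b - 2 = a + b - 2 - 2 := fun a b => by ring
  have e' : ∀ a b : ℤ, a + (b - 2) - 2 = a + b - 2 - 2 := fun a b => by ring
  have hL : ∀ {n m ω η}, ω ∈ Ctilde 𝕜 L n → η ∈ Ctilde 𝕜 L m →
      bracketFun (n - 2) m (contractZ z ω) η ∈ Ctilde 𝕜 L (n + m - 2 - 2) :=
    fun hω hη => bracketFun_mem (contractZ_mem hω z) hη (e _ _)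
  have hR : ∀ {n m ω η}, ω ∈ Ctilde 𝕜 L n → η ∈ Ctilde 𝕜 L m →
      bracketFun n (m - 2) ω (contractZ z η) ∈ Ctilde 𝕜 L (n + m - 2 - 2) :=
    fun hω hη => bracketFun_mem hω (contractZ_mem hη z) (e' _ _)
  unfold jacobiator
  rw [map_sub, map_sub, map_zsmul, contractZ_bracketFun hω (bracketFun_mem hη hμ rfl),
    contractZ_bracketFun hη hμ, contractZ_bracketFun (bracketFun_mem hω hη rfl) hμ,
    contractZ_bracketFun hω hη, contractZ_bracketFun hη (bracketFun_mem hω hμ rfl),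
    contractZ_bracketFun hω hμ,
    bracketFun_add_right (hL hη hμ) (hR hη hμ), bracketFun_add_left (hL hω hη) (hR hω hη),
    bracketFun_add_right (hL hω hμ) (hR hω hμ)]
  simp only [e, e']
  rcases sgn_cases n with h | h <;> rcases sgn_cases m with h' | h' <;>
    simp only [sgn_sub, sgn_two, h.1, h.2, h'.1, h'.2] <;> module

/-- The Jacobiator is a derivation in its first argument, here for products with a factor of degree
`0`. -/
theorem jacobiator_mul {α : PreCochain 𝕜 L} (hα : α ∈ Ctilde 𝕜 L 0) (hω : ω ∈ Ctilde 𝕜 L n)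
    (hη : η ∈ Ctilde 𝕜 L m) (hμ : μ ∈ Ctilde 𝕜 L l) :
    jacobiator n m l (mulLin 𝕜 L α ω) η μ = mulLin 𝕜 L α (jacobiator n m l ω η μ) +
      sgn (n * (m + l)) • mulLin 𝕜 L (jacobiator 0 m l α η μ) ω := by
  have p1 : mulLin 𝕜 L α (bracketFun n m ω η) ∈ Ctilde 𝕜 L (n + m - 2) :=
    mul_mem hα (bracketFun_mem hω hη rfl) (by ring)
  have p2 : mulLin 𝕜 L (bracketFun 0 m α η) ω ∈ Ctilde 𝕜 L (n + m - 2) :=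
    mul_mem (bracketFun_mem hα hη rfl) hω (by ring)
  have p3 : mulLin 𝕜 L α (bracketFun n l ω μ) ∈ Ctilde 𝕜 L (n + l - 2) :=
    mul_mem hα (bracketFun_mem hω hμ rfl) (by ring)
  have p4 : mulLin 𝕜 L (bracketFun 0 l α μ) ω ∈ Ctilde 𝕜 L (n + l - 2) :=
    mul_mem (bracketFun_mem hα hμ rfl) hω (by ring)
  unfold jacobiator
  rw [mul_bracketFun hα hω (bracketFun_mem hη hμ rfl) (zero_add n),
    mul_bracketFun hα hω hη (zero_add n), mul_bracketFun hα hω hμ (zero_add n),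
    bracketFun_add_left p1 (zsmul_mem p2 _), bracketFun_zsmul_left p2,
    bracketFun_add_right p3 (zsmul_mem p4 _), bracketFun_zsmul_right p4,
    mul_bracketFun hα (bracketFun_mem hω hη rfl) hμ (by ring),
    mul_bracketFun (bracketFun_mem hα hη rfl) hω hμ (by ring),
    bracketFun_mul hη hα (bracketFun_mem hω hμ rfl) (by ring),
    bracketFun_mul hη (bracketFun_mem hα hμ rfl) hω (by ring),
    bracketFun_antisymm hη hα, bracketFun_antisymm hη hω]
  simp only [map_neg, map_sub, map_zsmul, LinearMap.neg_apply, LinearMap.smul_apply,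
    LinearMap.sub_apply, zero_mul, mul_zero, sgn_zero, zero_add]
  rcases sgn_cases n with h | h <;> rcases sgn_cases m with h' | h' <;>
    rcases sgn_cases l with h'' | h'' <;>
    simp only [sgn_add, sgn_sub, sgn_two, h.1, h.2, h'.1, h'.2, h''.1, h''.2] <;> module

theorem jacobiator_add (hω : ω ∈ Ctilde 𝕜 L n) (hω' : ω' ∈ Ctilde 𝕜 L n)
    (hη : η ∈ Ctilde 𝕜 L m) (hμ : μ ∈ Ctilde 𝕜 L l) :
    jacobiator n m l (ω + ω') η μ = jacobiator n m l ω η μ + jacobiator n m l ω' η μ := by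
  unfold jacobiator
  rw [bracketFun_add_left hω hω', bracketFun_add_left hω hω', bracketFun_add_left hω hω',
    bracketFun_add_left (bracketFun_mem hω hη rfl) (bracketFun_mem hω' hη rfl),
    bracketFun_add_right (bracketFun_mem hω hμ rfl) (bracketFun_mem hω' hμ rfl)]
  module

theorem jacobiator_zero : jacobiator n m l 0 η μ = 0 := by
  simp [jacobiator, bracketFun_zero_left, bracketFun_zero_right]

theorem mulLin_const_const (s t : SZ 𝕜 L) : mulLin 𝕜 L (const s) (const t) = const (s * t) := by
  rw [eq_const (mul_mem (const_mem s) (const_mem t) (zero_add 0)), mulLin_nil]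
  rfl

theorem linearCochain_tmul (s : SZ 𝕜 L) (x : L) :
    linearCochain (s ⊗ₜ x) = mulLin 𝕜 L (const s) (linearCochain (1 ⊗ₜ x)) := by
  funext es fs
  rw [const_mul (linearCochain_mem _)]
  rcases es with _ | ⟨y, _ | _⟩ <;> rcases fs with _ | _ <;> simp [linearCochain, phi_tmul]

theorem linearCochain_add (u v : SZ 𝕜 L ⊗[𝕜] L) :
    linearCochain (u + v) = linearCochain u + linearCochain v := by
  funext es fs
  rcases es with _ | ⟨y, _ | _⟩ <;> rcases fs with _ | _ <;> simp [linearCochain]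

theorem jacobiator_const (hη : η ∈ Ctilde 𝕜 L m) (hμ : μ ∈ Ctilde 𝕜 L l) (s : SZ 𝕜 L) :
    jacobiator 0 m l (const s) η μ = 0 := by
  induction s using SymmetricAlgebra.induction with
  | algebraMap r =>
    unfold jacobiator
    rw [bracketFun_const_algebraMap (bracketFun_mem hη hμ rfl), bracketFun_const_algebraMap hη,
      bracketFun_const_algebraMap hμ, bracketFun_zero_left, bracketFun_zero_right]
    simp
  | ι z =>
    unfold jacobiator
    rw [bracketFun_const_ι (bracketFun_mem hη hμ rfl), bracketFun_const_ι hη,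
      bracketFun_const_ι hμ, contractZ_bracketFun hη hμ, zero_add, zero_add,
      bracketFun_neg_left (contractZ_mem hη z), bracketFun_neg_right (contractZ_mem hμ z),
      zero_mul, sgn_zero]
    module
  | mul a b ha hb =>
    rw [← mulLin_const_const, jacobiator_mul (const_mem a) (const_mem b) hη hμ, ha, hb]
    simp
  | add a b ha hb =>
    rw [const_add, jacobiator_add (const_mem a) (const_mem b) hη hμ, ha, hb, add_zero]

theorem jacobiator_linearCochain (hη : η ∈ Ctilde 𝕜 L m) (hμ : μ ∈ Ctilde 𝕜 L l)
    (u : SZ 𝕜 L ⊗[𝕜] L) : jacobiator 1 m l (linearCochain u) η μ = 0 := by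
  induction u with
  | zero =>
    have : linearCochain (0 : SZ 𝕜 L ⊗[𝕜] L) = 0 := by
      simpa using linearCochain_add (0 : SZ 𝕜 L ⊗[𝕜] L) 0
    rw [this, jacobiator_zero]
  | add a b ha hb =>
    rw [linearCochain_add, jacobiator_add (linearCochain_mem a) (linearCochain_mem b) hη hμ, ha,
      hb, add_zero]
  | tmul s x =>
    have h : jacobiator 1 m l (linearCochain (1 ⊗ₜ x)) η μ = 0 := by
      unfold jacobiator
      have e : ∀ a : ℤ, 1 + a - 2 = a - 1 := fun a => by ring
      rw [bracketFun_linearCochain (bracketFun_mem hη hμ rfl), bracketFun_linearCochain hη,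
        bracketFun_linearCochain hμ, contractL_bracketFun hη hμ, e, e, one_mul]
      module
    rw [linearCochain_tmul, jacobiator_mul (const_mem s) (linearCochain_mem _) hη hμ, h,
      jacobiator_const hη hμ]
    simp

/-- The Jacobi identity if the first cochain is generated by `Z` and the linear forms `(e, ·)` over
`S^•(Z)`. -/
theorem jacobiator_of_le_one (hω : ω ∈ Ctilde 𝕜 L n) (hη : η ∈ Ctilde 𝕜 L m)
    (hμ : μ ∈ Ctilde 𝕜 L l) (hn : n ≤ 1) : jacobiator n m l ω η μ = 0 := by
  rcases lt_trichotomy n 0 with h | rfl | h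
  · rw [eq_zero_of_neg hω h, jacobiator_zero]
  · rw [eq_const hω, jacobiator_const hη hμ]
  · obtain rfl : n = 1 := by omega
    obtain ⟨u, rfl⟩ := exists_eq_linearCochain hω
    exact jacobiator_linearCochain hη hμ u

/-- The initial case of the induction for the Jacobi identity. -/
theorem jacobiator_nil (hω : ω ∈ Ctilde 𝕜 L n) (hη : η ∈ Ctilde 𝕜 L m)
    (hμ : μ ∈ Ctilde 𝕜 L l) : jacobiator n m l ω η μ [] [] = 0 := by
  by_cases h : n + m + l = 4
  · -- one of the three degrees is at most one
    by_cases hn : n ≤ 1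
    · rw [jacobiator_of_le_one hω hη hμ hn]; rfl
    · by_cases hm : m ≤ 1
      · rw [jacobiator_swap_left hω hη, jacobiator_of_le_one hη hω hμ hm]
        simp
      · rw [jacobiator_swap_right hω hη hμ, jacobiator_swap_left hω hμ,
          jacobiator_of_le_one hμ hω hη (by omega)]
        simp
  · unfold jacobiator
    rw [Pi.sub_apply, Pi.sub_apply, Pi.sub_apply, Pi.sub_apply, Pi.smul_apply, Pi.smul_apply,
      bracketFun_nil_eq_zero hω (bracketFun_mem hη hμ rfl) (by omega),
      bracketFun_nil_eq_zero (bracketFun_mem hω hη rfl) hμ (by omega),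
      bracketFun_nil_eq_zero hη (bracketFun_mem hω hμ rfl) (by omega)]
    simp

theorem bracketFun_jacobi (hω : ω ∈ Ctilde 𝕜 L n) (hη : η ∈ Ctilde 𝕜 L m)
    (hμ : μ ∈ Ctilde 𝕜 L l) : bracketFun n (m + l - 2) ω (bracketFun m l η μ) =
      bracketFun (n + m - 2) l (bracketFun n m ω η) μ +
        sgn (n * m) • bracketFun m (n + l - 2) η (bracketFun n l ω μ) := by
  rw [← sub_eq_zero, ← sub_sub]
  set G : Set (PreCochain 𝕜 L) := {δ | ∃ (n m l : ℤ) (ω η μ : PreCochain 𝕜 L),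
    ω ∈ Ctilde 𝕜 L n ∧ η ∈ Ctilde 𝕜 L m ∧ μ ∈ Ctilde 𝕜 L l ∧
    δ = jacobiator n m l ω η μ} with hG
  have h1 := Submodule.subset_span (R := 𝕜) (s := G)
  refine eq_zero_of_contractions G ?_ ?_ ?_ _ ⟨n, m, l, ω, η, μ, hω, hη, hμ, rfl⟩
  · rintro _ ⟨n, m, l, ω, η, μ, hω, hη, hμ, rfl⟩
    exact jacobiator_nil hω hη hμ
  · rintro _ ⟨n, m, l, ω, η, μ, hω, hη, hμ, rfl⟩ x
    rw [contractL_jacobiator hω hη hμ]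
    exact add_mem (add_mem (h1 ⟨_, _, _, _, _, _, contractL_mem hω x, hη, hμ, rfl⟩)
      (zsmul_mem (h1 ⟨_, _, _, _, _, _, hω, contractL_mem hη x, hμ, rfl⟩) (sgn n)))
      (zsmul_mem (h1 ⟨_, _, _, _, _, _, hω, hη, contractL_mem hμ x, rfl⟩) (sgn (n + m)))
  · rintro _ ⟨n, m, l, ω, η, μ, hω, hη, hμ, rfl⟩ x
    rw [contractZ_jacobiator hω hη hμ]
    exact add_mem (add_mem (h1 ⟨_, _, _, _, _, _, contractZ_mem hω x, hη, hμ, rfl⟩)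
      (h1 ⟨_, _, _, _, _, _, hω, contractZ_mem hη x, hμ, rfl⟩))
      (h1 ⟨_, _, _, _, _, _, hω, hη, contractZ_mem hμ x, rfl⟩)

/-! ### The coboundary and the Cartan formula -/

theorem sum_fin_length_cons {α M : Type*} [AddCommMonoid M] (x : α) (es : List α)
    (F : Fin (x :: es).length → M) :
    ∑ a, F a = F ⟨0, Nat.succ_pos _⟩ + ∑ a : Fin es.length, F a.succ :=
  Fin.sum_univ_succ F

theorem get_cons_fin_succ {α : Type*} (x : α) (es : List α) (a : Fin es.length) :
    (x :: es).get a.succ = es.get a := rfl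

theorem get_cons_fin_zero {α : Type*} (x : α) (es : List α) (h : 0 < (x :: es).length) :
    (x :: es).get ⟨0, h⟩ = x := rfl

variable (𝕜 L) in
/-- The coboundary `d` as a linear map. -/
noncomputable def dLin : PreCochain 𝕜 L →ₗ[𝕜] PreCochain 𝕜 L where
  toFun := d
  map_add' ω η := by
    funext es fs
    simp only [d, Pi.add_apply, map_add, smul_add, ite_add_zero, Finset.sum_add_distrib]
    abel
  map_smul' c ω := by
    funext es fs
    simp only [d, Pi.smul_apply, Derivation.map_smul, RingHom.id_apply, smul_add, smul_sub,
      Finset.smul_sum, smul_ite, smul_zero, smul_comm c]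

/-- The Lie derivative `ℒ_e`: the action `ρ(e)` on values minus the sum of the actions `e ∘ ·` on
the arguments from `L` and `Z`. -/
noncomputable def lieDeriv (e : L) : PreCochain 𝕜 L →ₗ[𝕜] PreCochain 𝕜 L where
  toFun ω := fun es fs => rho 𝕜 e (ω es fs)
    - ∑ b : Fin es.length, ω (es.set b (op (𝕜 := 𝕜) e (es.get b))) fs
    - ∑ j : Fin fs.length, ω es (fs.set j (actZ 𝕜 L e (fs.get j)))
  map_add' ω η := by
    funext es fs
    simp only [Pi.add_apply, map_add, Finset.sum_add_distrib]
    abel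
  map_smul' c ω := by
    funext es fs
    simp only [Pi.smul_apply, Derivation.map_smul, RingHom.id_apply, smul_sub,
      Finset.smul_sum]

theorem lieDeriv_apply (e : L) (ω : PreCochain 𝕜 L) (es fs) :
    lieDeriv e ω es fs = rho 𝕜 e (ω es fs)
    - ∑ b : Fin es.length, ω (es.set b (op (𝕜 := 𝕜) e (es.get b))) fs
    - ∑ j : Fin fs.length, ω es (fs.set j (actZ 𝕜 L e (fs.get j))) := rfl

theorem contractL_lieDeriv (e x : L) (ω : PreCochain 𝕜 L) :
    contractL 𝕜 x (lieDeriv e ω) =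
      lieDeriv e (contractL 𝕜 x ω) - contractL 𝕜 (op (𝕜 := 𝕜) e x) ω := by
  funext es fs
  rw [contractL_apply, lieDeriv_apply, sum_fin_length_cons]
  simp only [Pi.sub_apply, lieDeriv_apply, contractL_apply, get_cons_fin_succ, Fin.val_succ,
    List.set_cons_succ, List.set_cons_zero, get_cons_fin_zero]
  abel

theorem contractZ_lieDeriv (e : L) (z : leftCenter 𝕜 L) (ω : PreCochain 𝕜 L) :
    contractZ z (lieDeriv e ω) =
      lieDeriv e (contractZ z ω) - contractZ (actZ 𝕜 L e z) ω := by
  funext es fs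
  rw [contractZ_apply, lieDeriv_apply, sum_fin_length_cons]
  simp only [Pi.sub_apply, lieDeriv_apply, contractZ_apply, get_cons_fin_succ, Fin.val_succ,
    List.set_cons_succ, List.set_cons_zero, get_cons_fin_zero]
  abel

/-- Here `z` is contracted as an element of `L` in the last term, which comes from the summand of `d`
that moves `z` to the arguments from `L`. -/
theorem contractZ_d (z : leftCenter 𝕜 L) (ω : PreCochain 𝕜 L) :
    contractZ z (dLin 𝕜 L ω) = dLin 𝕜 L (contractZ z ω) + contractL 𝕜 (z : L) ω := by
  funext es fs
  change d ω es (z :: fs) = d (contractZ z ω) es fs + contractL 𝕜 (z : L) ω es fs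
  rw [d, sum_fin_length_cons]
  simp only [d, contractL_apply, contractZ_apply, get_cons_fin_succ, Fin.val_succ,
    List.eraseIdx_cons_succ, List.eraseIdx_cons_zero, get_cons_fin_zero]
  abel

/-- Cartan's formula `ι_x d + d ι_x = ℒ_x`. -/
theorem contractL_d (hω : ω ∈ Ctilde 𝕜 L n) (x : L) :
    contractL 𝕜 x (dLin 𝕜 L ω) = lieDeriv x ω - dLin 𝕜 L (contractL 𝕜 x ω) := by
  funext es fs
  change d ω (x :: es) fs = lieDeriv x ω es fs - d (contractL 𝕜 x ω) es fs
  -- interchanging `f_j` and `x` yields the action of `x` on the arguments from `Z`, as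
  -- `(f_j, x) = x ∘ f_j`
  have h3 : ∑ j : Fin fs.length, ω ((fs.get j : L) :: x :: es) (fs.eraseIdx j) =
      -∑ j : Fin fs.length, ω es (fs.set j (actZ 𝕜 L x (fs.get j)))
        - ∑ j : Fin fs.length, ω (x :: (fs.get j : L) :: es) (fs.eraseIdx j) := by
    rw [eq_sub_iff_add_eq, ← Finset.sum_add_distrib, ← Finset.sum_neg_distrib]
    refine Finset.sum_congr rfl fun j _ => ?_
    have hc := (mem_Ctilde_iff.1 hω).1
    have h := hc.weak_skew [] es (fs.get j) x (fs.eraseIdx j)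
    rw [List.nil_append, List.nil_append, List.nil_append] at h
    rw [h, pair_comm, pair_leftCenter, hc.symm_Z es _ _ (List.set_perm_cons_eraseIdx j.2 _)]
  rw [d, h3]
  simp only [sum_fin_length_cons, d, lieDeriv_apply, contractL_apply, get_cons_fin_succ,
    Fin.val_succ, List.eraseIdx_cons_succ, List.eraseIdx_cons_zero, get_cons_fin_zero,
    List.set_cons_succ, Fin.succ_lt_succ_iff, pow_succ, pow_zero, one_smul, mul_neg, mul_one,
    neg_smul]
  have hneg : ∀ (P : Prop) [Decidable P] (a : SZ 𝕜 L),
      (if P then -a else 0) = -(if P then a else 0) := by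
    intro P _ a
    split_ifs <;> simp
  simp [hneg]
  abel

theorem lieDeriv_mem (hω : ω ∈ Ctilde 𝕜 L n) (e : L) : lieDeriv e ω ∈ Ctilde 𝕜 L n := by
  refine mem_Ctilde_of_contractions (fun n => {η | (∃ ω ∈ Ctilde 𝕜 L n, η = lieDeriv e ω) ∨
    η ∈ Ctilde 𝕜 L n}) ?_ ?_ ?_ (Or.inl ⟨ω, hω, rfl⟩)
  · rintro n _ (⟨ω, hω, rfl⟩ | h)
    · refine ⟨fun hn => ?_, ?_, fun c x y => ?_, fun c x y => ?_, fun x y => ?_, fun x y => ?_⟩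
      · rw [lieDeriv_apply, apply_eq_zero hω (by simpa using hn.symm)]
        simp
      · obtain ⟨u, hu⟩ := exists_phi hω [] []
        obtain ⟨v, hv⟩ := exists_phi_rho_sub e u
        refine ⟨v, fun x => ?_⟩
        rw [hv, hu, hu, lieDeriv_apply]
        simp
      · have h : op (𝕜 := 𝕜) e (c • x + y) = c • op (𝕜 := 𝕜) e x + op (𝕜 := 𝕜) e y := by simp
        simp only [contractL_lieDeriv, h, contractL_add_smul hω, map_add, map_smul]
        module
      · simp only [contractZ_lieDeriv, contractZ_add_smul hω, map_add, map_smul]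
        module
      · simp only [contractZ_lieDeriv, map_sub, contractZ_comm hω x,
          contractZ_comm hω (actZ 𝕜 L e x)]
        abel
      · have h0 := congrArg (lieDeriv e) (contractL_skew hω x y)
        have h1 := contractL_skew hω (op (𝕜 := 𝕜) e x) y
        have h2 := contractL_skew hω x (op (𝕜 := 𝕜) e y)
        have h3 := contractZ_add_smul hω 1 (pair 𝕜 L (op (𝕜 := 𝕜) e x) y)
          (pair 𝕜 L x (op (𝕜 := 𝕜) e y))
        rw [one_smul, one_smul] at h3
        simp only [contractZ_lieDeriv, contractL_lieDeriv, actZ_pair, map_sub, map_add, map_neg,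
          h3] at h0 ⊢
        linear_combination (norm := module) h0 - h1 - h2
    · exact Ctilde_le_initialConditions n h
  · rintro n _ (⟨ω, hω, rfl⟩ | h) x
    · rw [contractL_lieDeriv]
      exact Submodule.sub_mem _ (Submodule.subset_span (Or.inl ⟨_, contractL_mem hω x, rfl⟩))
        (Submodule.subset_span (Or.inr (contractL_mem hω _)))
    · exact Submodule.subset_span (Or.inr (contractL_mem h x))
  · rintro n _ (⟨ω, hω, rfl⟩ | h) x
    · rw [contractZ_lieDeriv]
      exact Submodule.sub_mem _ (Submodule.subset_span (Or.inl ⟨_, contractZ_mem hω x, rfl⟩))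
        (Submodule.subset_span (Or.inr (contractZ_mem hω _)))
    · exact Submodule.subset_span (Or.inr (contractZ_mem h x))

theorem lieDeriv_add_smul (hω : ω ∈ Ctilde 𝕜 L n) (c : 𝕜) (x y : L) :
    lieDeriv (c • x + y) ω = c • lieDeriv x ω + lieDeriv y ω := by
  funext es fs
  have hc := (mem_Ctilde_iff.1 hω).1
  have h1 : ∀ b : Fin es.length, ω (es.set b (op (𝕜 := 𝕜) (c • x + y) (es.get b))) fs =
      c • ω (es.set b (op (𝕜 := 𝕜) x (es.get b))) fs +
        ω (es.set b (op (𝕜 := 𝕜) y (es.get b))) fs := by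
    intro b
    simp only [List.set_eq_take_append_cons_drop, b.2, if_true, ← hc.linear_L, map_add, map_smul,
      LinearMap.add_apply, LinearMap.smul_apply]
  have h2 : ∀ j : Fin fs.length, ω es (fs.set j (actZ 𝕜 L (c • x + y) (fs.get j))) =
      c • ω es (fs.set j (actZ 𝕜 L x (fs.get j))) + ω es (fs.set j (actZ 𝕜 L y (fs.get j))) := by
    intro j
    have h : ∀ z, actZ 𝕜 L (c • x + y) z = c • actZ 𝕜 L x z + actZ 𝕜 L y z :=
      fun z => Subtype.ext (by simp [actZ])
    simp only [List.set_eq_take_append_cons_drop, j.2, if_true, ← hc.linear_Z, h]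
  simp only [lieDeriv_apply, h1, h2, rho_add_smul, Pi.add_apply, Pi.smul_apply,
    Finset.sum_add_distrib, smul_sub, Finset.smul_sum, Derivation.add_apply,
    Derivation.smul_apply]
  abel

theorem d_mem (hω : ω ∈ Ctilde 𝕜 L n) : d ω ∈ Ctilde 𝕜 L (n + 1) := by
  refine mem_Ctilde_of_contractions
    (fun k => {η | (∃ n, ∃ ω ∈ Ctilde 𝕜 L n, n + 1 = k ∧ η = dLin 𝕜 L ω) ∨
    η ∈ Ctilde 𝕜 L k}) ?_ ?_ ?_ (Or.inl ⟨n, ω, hω, rfl, rfl⟩)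
  · rintro _ _ (⟨n, ω, hω, rfl, rfl⟩ | h)
    · refine ⟨fun hn => ?_, ?_, fun c x y => ?_, fun c x y => ?_, fun x y => ?_, fun x y => ?_⟩
      · change d ω [] [] = 0
        simp [d]
      · obtain ⟨u, hu⟩ := exists_phi_rho (ω [] [])
        refine ⟨u, fun x => ?_⟩
        change _ = d ω [x] []
        rw [hu]
        simp [d]
      · simp only [contractL_d hω, contractL_add_smul hω, lieDeriv_add_smul hω, map_add, map_smul]
        module
      · simp only [contractZ_d, contractZ_add_smul hω, map_add, map_smul, Submodule.coe_add,
          Submodule.coe_smul, contractL_add_smul hω]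
        module
      · simp only [contractZ_d, map_add, contractZ_comm hω x, contractZ_contractL]
        abel
      · have h0 := congrArg (dLin 𝕜 L) (contractL_skew hω x y)
        have h1 := contractL_add_smul hω 1 (op (𝕜 := 𝕜) x y) (op (𝕜 := 𝕜) y x)
        have h2 : ((pair 𝕜 L x y : leftCenter 𝕜 L) : L) =
          op (𝕜 := 𝕜) x y + op (𝕜 := 𝕜) y x := rfl
        rw [one_smul, one_smul] at h1
        simp only [contractL_d hω, contractL_d (contractL_mem hω _), map_sub, contractL_lieDeriv,
          contractZ_d, h2, h1, map_add, map_neg] at h0 ⊢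
        linear_combination (norm := module) h0
    · exact Ctilde_le_initialConditions _ h
  · rintro _ _ (⟨n, ω, hω, rfl, rfl⟩ | h) x
    · rw [contractL_d hω]
      refine Submodule.sub_mem _ (Submodule.subset_span (Or.inr ?_))
        (Submodule.subset_span (Or.inl ⟨_, _, contractL_mem hω x, by ring, rfl⟩))
      rw [add_sub_cancel_right]
      exact lieDeriv_mem hω x
    · exact Submodule.subset_span (Or.inr (contractL_mem h x))
  · rintro _ _ (⟨n, ω, hω, rfl, rfl⟩ | h) x
    · rw [contractZ_d]
      refine Submodule.add_mem _
        (Submodule.subset_span (Or.inl ⟨_, _, contractZ_mem hω x, by ring, rfl⟩))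
        (Submodule.subset_span (Or.inr ?_))
      rw [show n + 1 - 2 = n - 1 by ring]
      exact contractL_mem hω x
    · exact Submodule.subset_span (Or.inr (contractZ_mem h x))

/-! ### The graded Poisson algebra -/

variable (𝕜 L) in
/-- The graded Poisson algebra of representable cochains. -/
noncomputable def poissonAlgebra : GradedPoissonAlgebra (Ctilde 𝕜 L) where
  one := ⟨const 1, const_mem 1⟩
  mul := LinearMap.mk₂ 𝕜 (fun ω η => ⟨mulLin 𝕜 L ω.1 η.1, mul_mem ω.2 η.2 rfl⟩)
    (fun _ _ _ => Subtype.ext (by simp)) (fun _ _ _ => Subtype.ext (by simp))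
    (fun _ _ _ => Subtype.ext (by simp)) (fun _ _ _ => Subtype.ext (by simp))
  bracket {n m} := LinearMap.mk₂ 𝕜
    (fun ω η => ⟨bracketFun n m ω.1 η.1, bracketFun_mem ω.2 η.2 rfl⟩)
    (fun ω ω' _ => Subtype.ext (bracketFun_add_left ω.2 ω'.2))
    (fun c ω _ => Subtype.ext (bracketFun_smul_left ω.2 c))
    (fun _ η η' => Subtype.ext (bracketFun_add_right η.2 η'.2))
    (fun c _ η => Subtype.ext (bracketFun_smul_right η.2 c))
  one_mul x := by
    funext es fs
    simp [const_mul x.2]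
  mul_one {n} x := by
    rw [LinearMap.mk₂_apply]
    change mulLin 𝕜 L x.1 (const 1) = x.1
    rw [mulLin_comm x.2 (const_mem 1), mul_zero, sgn_zero, one_smul]
    funext es fs
    simp [const_mul x.2]
  mul_assoc x y z := mulLin_assoc x.2 y.2 z.2
  mul_comm x y := mulLin_comm x.2 y.2
  bracket_antisymm x y := bracketFun_antisymm x.2 y.2
  bracket_mul x y z := bracketFun_mul x.2 y.2 z.2 rfl
  bracket_jacobi {n m l} x y z := by
    have h := bracketFun_jacobi x.2 y.2 z.2
    simpa only [LinearMap.mk₂_apply, add_sub_assoc] using h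

end Cochains
end LeibnizAlgebra

theorem theorem3p3 {𝕜 L : Type*} [Field 𝕜] [AddCommGroup L] [Module 𝕜 L] [LeibnizAlgebra 𝕜 L] :
    (∃ P : GradedPoissonAlgebra (LeibnizAlgebra.Ctilde 𝕜 L),
      (P.one : LeibnizAlgebra.PreCochain 𝕜 L) = LeibnizAlgebra.unit ∧
      (∀ {n m : ℤ} (ω : LeibnizAlgebra.Ctilde 𝕜 L n) (η : LeibnizAlgebra.Ctilde 𝕜 L m),
        (P.mul ω η : LeibnizAlgebra.PreCochain 𝕜 L) = LeibnizAlgebra.shuffleMul ω.1 η.1) ∧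
      (∀ {n m : ℤ} (ω : LeibnizAlgebra.Ctilde 𝕜 L n) (η : LeibnizAlgebra.Ctilde 𝕜 L m),
        (P.bracket ω η : LeibnizAlgebra.PreCochain 𝕜 L) = LeibnizAlgebra.poisson ω η)) ∧
    ∀ {n : ℤ}, ∀ ω ∈ LeibnizAlgebra.Ctilde 𝕜 L n,
      LeibnizAlgebra.d ω ∈ LeibnizAlgebra.Ctilde 𝕜 L (n + 1) :=
  ⟨⟨LeibnizAlgebra.poissonAlgebra 𝕜 L, LeibnizAlgebra.unit_eq.symm, fun _ _ => rfl,
    fun ω η => (LeibnizAlgebra.poisson_eq ω η).symm⟩, fun _ h => LeibnizAlgebra.d_mem h⟩
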